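/- Let $n$ be a positive integer, $T>0$, and $J=\begin{pmatrix}0&-I_n\\ I_n&0\end{pmatrix}$. Let $\langle\cdot,\cdot\rangle$ be the standard Hermitian inner product (linear in the first variable) and $\omega(x,y)=\langle Jx,y\rangle$ on $\mathbf C^{2n}$. All dimensions are complex. For a linear subspace $R\subset\mathbf C^n\times\mathbf C^n$ put $$R^{2,b}=\{(x_1,x_2)\in\mathbf C^{2n}:\ \langle x_1,y_1\rangle-\langle x_2,y_2\rangle=0\ \text{ for all }(y_1,y_2)\in R\},$$ $$W_2(R)=\{(x_1,x_2,x_3,x_4)\in\mathbf C^{4n}:\ (x_1,x_3)\in R^{2,b},\ (x_2,x_4)\in R\},$$ a Lagrangian subspace of $(\mathbf C^{2n}\oplus\mathbf C^{2n},(-\omega)\oplus\omega)$. Write $\mathrm{Gr}(M)=\{(x,Mx)\}$ for the graph of $M$. Maslov-type index. Let $W$ be a Lagrangian subspace of $(\mathbf C^{2n}\oplus\mathbf C^{2n},(-\omega)\oplus\omega)$ and $\gamma(t)$, $0\le t\le T$, a continuous path of matrices with $\gamma(t)^*J\gamma(t)=J$. Let $H^{\pm}$ be the positive and negative spaces of the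 self-adjoint matrix $-\sqrt{-1}\,\mathrm{diag}(-J,J)$. Then $\mathrm{Gr}(\gamma(t))=\{x+U_tx:x\in H^+\}$ and $W=\{x+Vx:x\in H^+\}$ for unique invertible linear maps $U_t,V:H^+\to H^-$, and $U_tV^{-1}$ has its spectrum on the unit circle. Define $i_W(\gamma)=-\mathrm{sf}\{U_tV^{-1}\}$, where $\mathrm{sf}$ is the net number of eigenvalues, with multiplicity, that pass upward through $1$, an eigenvalue at $1$ being counted on the upper side: for a partition $0=s_0\le\dots\le s_m=T$ and angles $\varepsilon_j\in(0,\pi)$ such that no $U_tV^{-1}$ with $t\in[s_j,s_{j+1}]$ has an eigenvalue $z$ with $|\arg z|=\varepsilon_j$, $$\mathrm{sf}=\sum_{j=0}^{m-1}\left(\nu_j(s_j)-\nu_j(s_{j+1})\right),$$ where $\nu_j(t)$ is the number of eigenvalues $z$ of $U_tV^{-1}$ with $-\varepsilon_j<\arg z<0$. Such data exist, and the number does not depend on their choice. **Theorem.** Let $a(t)$, $0\le t\le T$, be a continuous path in $\mathrm{GL}(n,\mathbf C)$, let $R\subset\mathbf C^n\times\mathbf C^n$ be a linear subspace, and let $$R'=\{(x,y)\in\mathbf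 C^{2n}:\ (a(0)x,a(T)y)\in R\}.$$ Let $\gamma$ be a continuous symplectic path, i.e. $\gamma(t)^*J\gamma(t)=J$ for all $0\le t\le T$, with $\gamma(0)=I_{2n}$. Define the symplectic path $\gamma'$ by $$\gamma'(t)=\mathrm{diag}\left(a(t)^*,a(t)^{-1}\right)\,\gamma(t)\,\mathrm{diag}\left(a(0)^{*-1},a(0)\right).$$ Then the indices $i_{W_2(R)}(\gamma)$ and $i_{W_2(R')}(\gamma')$ are well defined, and $$i_{W_2(R')}(\gamma')-i_{W_2(R)}(\gamma)=\dim\left(\mathrm{Gr}(I_n)\cap(R')^{2,b}\right)-\dim\left(\mathrm{Gr}(I_n)\cap R^{2,b}\right).$$ -/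

import Mathlib

open Matrix

noncomputable section

namespace MaslovTheory

/-- The dimension of the image of the spectral projection `P(A, N)` in finite dimension: the
dimension of the sum of the generalized eigenspaces of `A` for the eigenvalues lying in `N`. -/
def spectralDim {V : Type*} [AddCommGroup V] [Module ℂ V] (A : Module.End ℂ V) (N : Set ℂ) : ℕ :=
  Module.finrank ℂ (⨆ z ∈ N, A.maxGenEigenspace z : Submodule ℂ V)

/-- The part `N⁻` below the real axis of the neighbourhood `{z : |arg z| < ε}` of the point `1`
of the unit circle. -/
def lowerSector (ε : ℝ) : Set ℂ := {z | z.arg ∈ Set.Ioo (-ε) 0}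

/-- `k` is the spectral flow of the path `A t`, `a ≤ t ≤ b`, of operators with spectrum on the
unit circle, through the point `1`, that is, with respect to `ℓ = (1 - δ, 1 + δ) ⊂ ℝ` co-oriented
upward. There are a partition `a = s₀ ≤ … ≤ s_m = b` and angles `ε_j ∈ (0, π)`
such that no eigenvalue of `A t` for `t ∈ [s_j, s_{j+1}]` lies on the boundary `|arg z| = ε_j`
of `N_j = {|arg z| < ε_j}`, and
`k = ∑_j (dim im P(A s_j, N_j⁻) - dim im P(A s_{j+1}, N_j⁻))`.
Eigenvalues at `1` are counted on the non-negative side. -/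
def HasSpectralFlow {V : Type*} [AddCommGroup V] [Module ℂ V] (a b : ℝ)
    (A : ℝ → Module.End ℂ V) (k : ℤ) : Prop :=
  ∃ (m : ℕ) (s : ℕ → ℝ) (ε : ℕ → ℝ), Monotone s ∧ s 0 = a ∧ s m = b ∧
    (∀ j < m, ε j ∈ Set.Ioo 0 Real.pi ∧
      ∀ t ∈ Set.Icc (s j) (s (j + 1)), ∀ z : ℂ, (A t).HasEigenvalue z → |z.arg| ≠ ε j) ∧
    k = ∑ j ∈ Finset.range m,
      ((spectralDim (A (s j)) (lowerSector (ε j)) : ℤ) -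
        (spectralDim (A (s (j + 1))) (lowerSector (ε j)) : ℤ))

/-- The positive space of a self-adjoint operator. -/
def positiveSpace {V : Type*} [AddCommGroup V] [Module ℂ V] (A : Module.End ℂ V) :
    Submodule ℂ V :=
  ⨆ c : {c : ℝ // 0 < c}, A.eigenspace ((c : ℝ) : ℂ)

/-- The negative space of a self-adjoint operator. -/
def negativeSpace {V : Type*} [AddCommGroup V] [Module ℂ V] (A : Module.End ℂ V) :
    Submodule ℂ V :=
  ⨆ c : {c : ℝ // c < 0}, A.eigenspace ((c : ℝ) : ℂ)

/-- The graph `{x + U x : x ∈ H⁺}` of a map `U : H⁺ → H⁻` between subspaces. -/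
def splitGraph {V : Type*} [AddCommGroup V] [Module ℂ V] {Hp Hm : Submodule ℂ V}
    (U : Hp →ₗ[ℂ] Hm) : Submodule ℂ V :=
  LinearMap.range (Hp.subtype + Hm.subtype ∘ₗ U)

/-- `k` is the Maslov index of the path of pairs `(L t, M t)`, `a ≤ t ≤ b`, of Lagrangian
subspaces of the symplectic space whose form is `ω(x, y) = ⟨𝒥 x, y⟩`, with `𝒥` skew self-adjoint
and invertible. Let `H⁺`, `H⁻` be the positive and negative spaces of `-i𝒥`,
so that `-iω` is positive definite on `H⁺` and negative definite on `H⁻`. Lagrangian subspaces are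
the graphs of maps `H⁺ → H⁻` that carry `ω` to `-ω`; if `L t` and `M t` are the graphs of `U t`
and `V t`, the index is minus the spectral flow of `U t ∘ (V t)⁻¹ : H⁻ → H⁻` through `1`. -/
def HasMaslovIndex {V : Type*} [AddCommGroup V] [Module ℂ V] (𝒥 : Module.End ℂ V) (a b : ℝ)
    (L M : ℝ → Submodule ℂ V) (k : ℤ) : Prop :=
  ∃ U W : ℝ → (positiveSpace (-Complex.I • 𝒥) ≃ₗ[ℂ] negativeSpace (-Complex.I • 𝒥)),
    (∀ t ∈ Set.Icc a b,
      L t = splitGraph (U t).toLinearMap ∧ M t = splitGraph (W t).toLinearMap) ∧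
    HasSpectralFlow a b (fun t => (U t).toLinearMap ∘ₗ (W t).symm.toLinearMap) (-k)

/-- `ℂ²ⁿ`, as column vectors with two blocks of length `n`. -/
abbrev C2n (n : ℕ) : Type := Fin n ⊕ Fin n → ℂ

/-- The operator `(-J) ⊕ J` of the symplectic form `(-ω) ⊕ ω` on `ℂ²ⁿ ⊕ ℂ²ⁿ`, where
`ω(x, y) = ⟨J x, y⟩` and `J` is the block matrix with rows `(0, -I)` and `(I, 0)`. -/
def graphForm (n : ℕ) : Module.End ℂ (C2n n × C2n n) :=
  LinearMap.prodMap (-(Matrix.toLin' (Matrix.J (Fin n) ℂ))) (Matrix.toLin' (Matrix.J (Fin n) ℂ))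

/-- `k` is the Maslov-type index `i_W(γ)` of the symplectic path `γ t`, `0 ≤ t ≤ T`, with respect
to the Lagrangian subspace `W` of `(ℂ²ⁿ ⊕ ℂ²ⁿ, (-ω) ⊕ ω)`: the Maslov index of the pair
`(Gr(γ t), W)`. -/
def HasMaslovTypeIndex {n : ℕ} (T : ℝ) (W : Submodule ℂ (C2n n × C2n n))
    (γ : ℝ → Matrix (Fin n ⊕ Fin n) (Fin n ⊕ Fin n) ℂ) (k : ℤ) : Prop :=
  HasMaslovIndex (graphForm n) 0 T (fun t => (Matrix.toLin' (γ t)).graph) (fun _ => W) k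

open Classical in
/-- The Maslov-type index `i_W(γ)`, with value `0` where it is not defined. -/
def maslovTypeIndex {n : ℕ} (T : ℝ) (W : Submodule ℂ (C2n n × C2n n))
    (γ : ℝ → Matrix (Fin n ⊕ Fin n) (Fin n ⊕ Fin n) ℂ) : ℤ :=
  if h : ∃ k, HasMaslovTypeIndex T W γ k then h.choose else 0

/-- `R^{2,b}`: the pairs `(x₁, x₂)` with `⟨x₁, y₁⟩ - ⟨x₂, y₂⟩ = 0` for all `(y₁, y₂) ∈ R`, where
`⟨x, y⟩ = ∑ i, x i * conj (y i)`. -/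
def dualBoundary {n : ℕ} (R : Submodule ℂ ((Fin n → ℂ) × (Fin n → ℂ))) :
    Submodule ℂ ((Fin n → ℂ) × (Fin n → ℂ)) where
  carrier := {x | ∀ y ∈ R, x.1 ⬝ᵥ star y.1 - x.2 ⬝ᵥ star y.2 = 0}
  add_mem' {x x'} hx hx' y hy := by
    have h₁ := hx y hy
    have h₂ := hx' y hy
    simp only [Prod.fst_add, Prod.snd_add, add_dotProduct]
    linear_combination h₁ + h₂
  zero_mem' y _ := by simp
  smul_mem' c x hx y hy := by
    have h₁ := hx y hy
    simp only [Prod.smul_fst, Prod.smul_snd, smul_dotProduct, smul_eq_mul]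
    linear_combination c * h₁

/-- `W₂(R)`: the `(x₁, x₂, x₃, x₄)` with `(x₁, x₃) ∈ R^{2,b}` and `(x₂, x₄) ∈ R`, where `(x₁, x₂)`
and `(x₃, x₄)` are the two components in `ℂ²ⁿ`. -/
def boundaryLagrangian {n : ℕ} (R : Submodule ℂ ((Fin n → ℂ) × (Fin n → ℂ))) :
    Submodule ℂ (C2n n × C2n n) :=
  (dualBoundary R).comap
      (LinearMap.prodMap (LinearMap.funLeft ℂ ℂ Sum.inl) (LinearMap.funLeft ℂ ℂ Sum.inl)) ⊓
    R.comap (LinearMap.prodMap (LinearMap.funLeft ℂ ℂ Sum.inr) (LinearMap.funLeft ℂ ℂ Sum.inr))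

/-- `Gr(I_n) = {(x, x)}`. -/
def diagonal (n : ℕ) : Submodule ℂ ((Fin n → ℂ) × (Fin n → ℂ)) :=
  LinearMap.graph LinearMap.id

/-- `R' = {(x, y) : (a(0) x, a(T) y) ∈ R}`. -/
def changeBoundary {n : ℕ} (a₀ a₁ : Matrix (Fin n) (Fin n) ℂ)
    (R : Submodule ℂ ((Fin n → ℂ) × (Fin n → ℂ))) : Submodule ℂ ((Fin n → ℂ) × (Fin n → ℂ)) :=
  R.comap (LinearMap.prodMap (Matrix.toLin' a₀) (Matrix.toLin' a₁))

/-- `γ'(t) = diag(a(t)*, a(t)⁻¹) γ(t) diag(a(0)*⁻¹, a(0))`. -/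
def changePath {n : ℕ} (a : ℝ → Matrix (Fin n) (Fin n) ℂ)
    (γ : ℝ → Matrix (Fin n ⊕ Fin n) (Fin n ⊕ Fin n) ℂ) (t : ℝ) :
    Matrix (Fin n ⊕ Fin n) (Fin n ⊕ Fin n) ℂ :=
  Matrix.fromBlocks (a t)ᴴ 0 0 (a t)⁻¹ * γ t * Matrix.fromBlocks ((a 0)ᴴ)⁻¹ 0 0 (a 0)

end MaslovTheory

end

/-!
Attach to a pair of Lagrangian subspaces, written as graphs of maps `U, V : H⁺ → H⁻`, the unitary
matrix `U V⁻¹`. Its spectral flow through `1` along a path is, up to the factor `2π`, the change of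
a continuous argument of `det (U V⁻¹)` minus the change of `argSum 0`, the sum of the arguments of
the eigenvalues taken in `[0, 2π)` (`HasSpectralFlow.two_pi_mul_eq`). Indeed, while no eigenvalue
meets `exp (-iε)`, the sum of the arguments taken in `[-ε, 2π - ε)` is itself a continuous argument
of the determinant, and it differs from `argSum 0` by `-2π` for each eigenvalue on the arc below
`1`. This makes the index unique and turns homotopy arguments into statements about one continuous
argument `θ` of the determinant on a simply connected parameter space.

Let `D b = diag(b*, b⁻¹)`. The graph of `γ' t` is the graph of `γ t` moved by the symplectic map
`D (a 0) ⊕ D (a t)`, and `D (a 0) ⊕ D (a T)` takes `W₂(R)` to `W₂(R')`. Prolong `a` to a path `b` of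
invertible matrices that starts at `1` at time `-1`, and consider for `(r, s, t)` the graph of `γ t`
moved by `D (b r) ⊕ D (b s)`. The path of `γ` runs from `(-1, -1, 0)` to `(-1, -1, T)` and that of
`γ'` from `(0, 0, 0)` to `(0, T, T)`, in the same three-dimensional family. Three facts compare the
two indices (`index_difference`).

* `det V` does not depend on the point, and on the face `t = 0`, where the graph is a direct sum of
  a position and a momentum part, `det U` is constant as well
  (`IsLagrangianFrame.det_frameUnitary`), so `θ` takes the same value at both starting points.
* On the face `t = T`, if `W₂(R)` is moved along with the graph, the dimension of the intersection,
  which is the multiplicity of the eigenvalue `1`, stays constant. Then no eigenvalue crosses `1`,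
  and `θ - argSum 0` takes the same value at both end points (`sub_argSum_eq`).
* At the starting points `U` and `V` are both involutions, so the spectrum of `U V⁻¹` is symmetric
  about the real axis and `argSum 0` equals `π (2n - k)`, where `k` is the dimension of the
  intersection of the graph of the identity with the boundary condition (`argSum_charpoly_mul`).

Hence twice the index difference is the difference of the dimensions `k`. Each of them is the sum of
the dimensions of the intersections of the diagonal with `R^{2,b}` and with `R`, and these two
differ by `dim R - n` (`finrank_diagonal_inf_dualBoundary`), which is the same for `R` and `R'`.
-/

noncomputable section

namespace MaslovTheory

open Polynomial Filter Topology ComplexOrder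

/-! ### Branches of the argument -/

/-- The branch of the argument on the unit circle with values in `[-ε, 2π - ε)`. It is written
through the principal argument of `-conj z * exp (-iε)`, so that its jump is at `exp (-iε)` and
its value there is `-ε`. -/
def branchArg (ε : ℝ) (z : ℂ) : ℝ :=
  Real.pi - ε - Complex.arg (-(starRingEnd ℂ z * Complex.exp (((-ε : ℝ) : ℂ) * Complex.I)))

lemma exp_arg_mul_I_of_norm_eq_one {z : ℂ} (hz : ‖z‖ = 1) :
    Complex.exp (z.arg * Complex.I) = z := by
  simpa [hz] using Complex.norm_mul_exp_arg_mul_I z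

lemma branchArg_exp (ε α : ℝ) :
    branchArg ε (Complex.exp (α * Complex.I)) =
      Real.pi - ε - toIocMod Real.two_pi_pos (-Real.pi) (Real.pi - ε - α) := by
  have h : -(starRingEnd ℂ (Complex.exp (α * Complex.I)) *
      Complex.exp (((-ε : ℝ) : ℂ) * Complex.I)) =
      Complex.exp (((Real.pi - ε - α : ℝ) : ℂ) * Complex.I) := by
    rw [← Complex.exp_conj, map_mul, Complex.conj_I, Complex.conj_ofReal, ← Complex.exp_add]
    have : (((Real.pi - ε - α : ℝ) : ℂ) * Complex.I) =
        (Real.pi : ℂ) * Complex.I + (α * -Complex.I + ((-ε : ℝ) : ℂ) * Complex.I) := by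
      push_cast; ring
    rw [this, Complex.exp_add _ (_ + _), Complex.exp_pi_mul_I]
    ring
  rw [branchArg, h, Complex.arg_exp_mul_I]

lemma branchArg_of_neg_le_arg {ε : ℝ} (hε : ε < Real.pi) {z : ℂ} (hz : ‖z‖ = 1)
    (h : -ε ≤ z.arg) : branchArg ε z = z.arg := by
  conv_lhs => rw [← exp_arg_mul_I_of_norm_eq_one hz]
  rw [branchArg_exp, (toIocMod_eq_iff Real.two_pi_pos).2 ⟨_, 0, (by simp; rfl)⟩]
  · ring
  · have := z.arg_le_pi
    constructor <;> linarith

lemma branchArg_of_arg_lt_neg {ε : ℝ} (hε : 0 ≤ ε) {z : ℂ} (hz : ‖z‖ = 1)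
    (h : z.arg < -ε) : branchArg ε z = z.arg + 2 * Real.pi := by
  conv_lhs => rw [← exp_arg_mul_I_of_norm_eq_one hz]
  rw [branchArg_exp, (toIocMod_eq_iff Real.two_pi_pos (c := -Real.pi - ε - z.arg)).2 ⟨?_, 1, ?_⟩]
  · ring
  · have := z.neg_pi_lt_arg
    constructor <;> linarith
  · simp; ring

lemma exp_branchArg (ε : ℝ) {z : ℂ} (hz : ‖z‖ = 1) :
    Complex.exp (branchArg ε z * Complex.I) = z := by
  conv_rhs => rw [← exp_arg_mul_I_of_norm_eq_one hz]
  conv_lhs => rw [← exp_arg_mul_I_of_norm_eq_one hz]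
  rw [branchArg_exp, Complex.exp_eq_exp_iff_exists_int]
  refine ⟨toIocDiv Real.two_pi_pos (-Real.pi) (Real.pi - ε - z.arg), ?_⟩
  have h := self_sub_toIocDiv_zsmul Real.two_pi_pos (-Real.pi) (Real.pi - ε - z.arg)
  rw [← h]
  simp only [zsmul_eq_mul]
  push_cast
  ring

lemma continuousAt_branchArg {ε : ℝ} {z : ℂ} (hz : ‖z‖ = 1)
    (h : z ≠ Complex.exp (((-ε : ℝ) : ℂ) * Complex.I)) : ContinuousAt (branchArg ε) z := by
  unfold branchArg
  refine continuousAt_const.sub (ContinuousAt.comp (g := Complex.arg)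
    (Complex.continuousAt_arg ?_) (by fun_prop))
  have hn : ‖-(starRingEnd ℂ z * Complex.exp (((-ε : ℝ) : ℂ) * Complex.I))‖ = 1 := by
    rw [norm_neg, norm_mul, Complex.norm_conj, hz, Complex.norm_exp_ofReal_mul_I, one_mul]
  rw [Complex.mem_slitPlane_iff_arg]
  refine ⟨fun hp => h ?_, fun h0 => by rw [h0, norm_zero] at hn; exact zero_ne_one hn⟩
  have h1 := exp_arg_mul_I_of_norm_eq_one hn
  rw [hp, Complex.exp_pi_mul_I] at h1
  have h2 : starRingEnd ℂ z * Complex.exp (((-ε : ℝ) : ℂ) * Complex.I) = 1 := by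
    linear_combination h1
  have h3 : z * starRingEnd ℂ z = 1 := by
    rw [Complex.mul_conj, Complex.normSq_eq_norm_sq, hz]; simp
  linear_combination z * (-h2) + Complex.exp (((-ε : ℝ) : ℂ) * Complex.I) * h3

/-- Moving the cut of the argument from `1` to `exp (-iε)` changes the argument by `-2π` exactly on
the open arc below `1`. -/
lemma branchArg_sub_branchArg_zero {ε : ℝ} (hε : ε ∈ Set.Ioo 0 Real.pi) {z : ℂ} (hz : ‖z‖ = 1)
    (h : |z.arg| ≠ ε) [Decidable (z ∈ lowerSector ε)] :
    branchArg ε z - branchArg 0 z = if z ∈ lowerSector ε then -(2 * Real.pi) else 0 := by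
  have hne : z.arg ≠ -ε := fun h' => h (by rw [h', abs_neg, abs_of_pos hε.1])
  rcases lt_or_ge z.arg (-ε) with h1 | h1
  · have : z ∉ lowerSector ε := fun h2 => by have := h2.1; linarith
    rw [if_neg this, branchArg_of_arg_lt_neg hε.1.le hz h1,
      branchArg_of_arg_lt_neg le_rfl hz (by linarith [hε.1])]
    ring
  · rcases lt_or_ge z.arg 0 with h2 | h2
    · have : z ∈ lowerSector ε := ⟨lt_of_le_of_ne h1 hne.symm, h2⟩
      rw [if_pos this, branchArg_of_neg_le_arg hε.2 hz h1,
        branchArg_of_arg_lt_neg le_rfl hz (by linarith)]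
      ring
    · have : z ∉ lowerSector ε := fun h3 => by have := h3.2; linarith
      rw [if_neg this, branchArg_of_neg_le_arg hε.2 hz h1,
        branchArg_of_neg_le_arg Real.pi_pos hz (by linarith)]
      ring

lemma branchArg_zero_add_conj {z : ℂ} (hz : ‖z‖ = 1) [Decidable (z = 1)] :
    branchArg 0 z + branchArg 0 (starRingEnd ℂ z) = if z = 1 then 0 else 2 * Real.pi := by
  have hz' : ‖starRingEnd ℂ z‖ = 1 := by rw [Complex.norm_conj, hz]
  have key : ∀ w : ℂ, ‖w‖ = 1 →
      branchArg 0 w = if w.arg < 0 then w.arg + 2 * Real.pi else w.arg := by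
    intro w hw
    split_ifs with h
    · exact branchArg_of_arg_lt_neg le_rfl hw (by linarith)
    · exact branchArg_of_neg_le_arg Real.pi_pos hw (by linarith)
  rw [key z hz, key _ hz', Complex.arg_conj]
  have hpi := Real.pi_pos
  by_cases h1 : z = 1
  · subst h1
    simp [hpi.ne]
  · have h0 : z.arg ≠ 0 := fun h0 => h1 (by
      rw [← exp_arg_mul_I_of_norm_eq_one hz, h0]; simp)
    rw [if_neg h1]
    split_ifs <;> first | linarith | (exfalso; apply h0; linarith)

/-! ### Polynomials with roots on the unit circle -/

/-- Monic polynomials of degree `N` all of whose roots, listed with multiplicity by `τ`, lie on the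
unit circle. -/
def IsCirclePoly (N : ℕ) (p : ℂ[X]) : Prop :=
  ∃ τ : Fin N → ℂ, (∀ i, ‖τ i‖ = 1) ∧ p = ∏ i, (X - C (τ i))

/-- The sum of the arguments of the roots of `p`, taken in `[-ε, 2π - ε)`. -/
def argSum (ε : ℝ) (p : ℂ[X]) : ℝ := (p.roots.map (branchArg ε)).sum

lemma roots_prod_X_sub_C_fin {N : ℕ} (τ : Fin N → ℂ) :
    (∏ i, (X - C (τ i))).roots = Finset.univ.val.map τ := by
  have := roots_multiset_prod_X_sub_C (Finset.univ.val.map τ)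
  rwa [Multiset.map_map] at this

lemma argSum_prod (ε : ℝ) {N : ℕ} (τ : Fin N → ℂ) :
    argSum ε (∏ i, (X - C (τ i))) = ∑ i, branchArg ε (τ i) := by
  rw [argSum, roots_prod_X_sub_C_fin, Multiset.map_map]
  rfl

lemma rootMultiplicity_prod {N : ℕ} (τ : Fin N → ℂ) (ζ : ℂ) :
    rootMultiplicity ζ (∏ i, (X - C (τ i))) = (Finset.univ.filter (fun i => τ i = ζ)).card := by
  classical
  rw [← count_roots, roots_prod_X_sub_C_fin, Multiset.count_map]
  simp only [eq_comm (a := ζ)]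
  rfl

lemma IsCirclePoly.norm_eq_one {N : ℕ} {p : ℂ[X]} (hp : IsCirclePoly N p) {z : ℂ}
    (hz : z ∈ p.roots) : ‖z‖ = 1 := by
  obtain ⟨τ, hτ, rfl⟩ := hp
  rw [roots_prod_X_sub_C_fin, Multiset.mem_map] at hz
  obtain ⟨i, -, rfl⟩ := hz
  exact hτ i

lemma IsCirclePoly.exp_argSum {N : ℕ} {p : ℂ[X]} (hp : IsCirclePoly N p) (ε : ℝ) :
    Complex.exp (argSum ε p * Complex.I) = p.roots.prod := by
  obtain ⟨τ, hτ, rfl⟩ := hp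
  rw [argSum_prod, roots_prod_X_sub_C_fin]
  push_cast
  rw [Finset.sum_mul, Complex.exp_sum]
  exact Finset.prod_congr rfl fun i _ => exp_branchArg ε (hτ i)

/-- Roots depend continuously on the coefficients: along an ultrafilter they can be numbered so
that each of them converges. -/
lemma exists_tendsto_roots {X' : Type*} (u : Ultrafilter X') {N : ℕ} {p : X' → ℂ[X]} {p₀ : ℂ[X]}
    (hp : ∀ᶠ x in (u : Filter X'), IsCirclePoly N (p x))
    (hlim : ∀ z, Tendsto (fun x => (p x).eval z) u (𝓝 (p₀.eval z))) :
    ∃ (τ : X' → Fin N → ℂ) (w : Fin N → ℂ),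
      (∀ᶠ x in (u : Filter X'), (∀ i, ‖τ x i‖ = 1) ∧ p x = ∏ i, (X - C (τ x i))) ∧
      (∀ i, Tendsto (fun x => τ x i) u (𝓝 (w i))) ∧ (∀ i, ‖w i‖ = 1) ∧
      p₀ = ∏ i, (X - C (w i)) := by
  classical
  let τ : X' → Fin N → ℂ := fun x => if h : IsCirclePoly N (p x) then h.choose else 1
  have hτ : ∀ᶠ x in (u : Filter X'), (∀ i, ‖τ x i‖ = 1) ∧ p x = ∏ i, (X - C (τ x i)) := by
    filter_upwards [hp] with x hx
    simp only [τ, dif_pos hx]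
    exact hx.choose_spec
  have hcomp : IsCompact (Set.univ.pi fun _ : Fin N => Metric.sphere (0 : ℂ) 1) :=
    isCompact_univ_pi fun _ => isCompact_sphere 0 1
  obtain ⟨w, hw, hle⟩ := hcomp.ultrafilter_le_nhds (u.map τ) (by
    rw [le_principal_iff, Ultrafilter.coe_map, mem_map]
    filter_upwards [hτ] with x hx
    simpa [Set.mem_pi] using hx.1)
  have hw' : ∀ i, Tendsto (fun x => τ x i) u (𝓝 (w i)) := fun i =>
    ((continuous_apply i).tendsto w).comp (show Tendsto τ u (𝓝 w) from hle)
  refine ⟨τ, w, hτ, hw', fun i => by simpa using hw i (Set.mem_univ i), ?_⟩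
  refine Polynomial.funext fun z => tendsto_nhds_unique (hlim z) ?_
  have h1 : Tendsto (fun x => ∏ i, (z - τ x i)) u (𝓝 (∏ i, (z - w i))) :=
    tendsto_finsetProd _ fun i _ => tendsto_const_nhds.sub (hw' i)
  rw [eval_prod]
  simp only [eval_sub, eval_X, eval_C]
  refine h1.congr' ?_
  filter_upwards [hτ] with x hx
  rw [hx.2, eval_prod]
  simp

/-- As long as the multiplicity of the root at the cut does not change, the sum of the arguments of
the roots is continuous. -/
lemma continuousOn_argSum {X' : Type*} [TopologicalSpace X'] {s : Set X'} {N : ℕ}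
    {p : X' → ℂ[X]} (hp : ∀ x ∈ s, IsCirclePoly N (p x))
    (hc : ∀ z, ContinuousOn (fun x => (p x).eval z) s) (ε : ℝ) (k : ℕ)
    (hk : ∀ x ∈ s, rootMultiplicity (Complex.exp (((-ε : ℝ) : ℂ) * Complex.I)) (p x) = k) :
    ContinuousOn (fun x => argSum ε (p x)) s := by
  classical
  set ζ := Complex.exp (((-ε : ℝ) : ℂ) * Complex.I) with hζ
  intro x hx
  rw [ContinuousWithinAt, Filter.tendsto_iff_ultrafilter]
  intro u hu
  have hus : ∀ᶠ y in (u : Filter X'), y ∈ s := hu self_mem_nhdsWithin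
  obtain ⟨τ, w, hτ, hw, hw1, hp0⟩ := exists_tendsto_roots u
    (hus.mono fun y hy => hp y hy) (fun z => (hc z x hx).mono_left hu)
  rw [hp0, argSum_prod]
  -- Each root stays at the cut or stays away from it; the former account for the whole
  -- multiplicity of the limit at the cut, so none of the latter can converge to it.
  let I₀ : Finset (Fin N) := Finset.univ.filter fun i => ∀ᶠ y in (u : Filter X'), τ y i = ζ
  have hI : ∀ᶠ y in (u : Filter X'), ∀ i, τ y i = ζ ↔ i ∈ I₀ := by
    rw [Filter.eventually_all]
    intro i
    by_cases hi : ∀ᶠ y in (u : Filter X'), τ y i = ζ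
    · filter_upwards [hi] with y hy
      simp [I₀, hy, hi]
    · filter_upwards [Ultrafilter.eventually_not.2 hi] with y hy
      simp [I₀, hy, hi]
  have hcard : I₀.card = k := by
    obtain ⟨y, hyI, hyτ, hys⟩ := (hI.and (hτ.and hus)).exists
    have h1 := hk y hys
    rw [hyτ.2, rootMultiplicity_prod] at h1
    rw [← h1]
    congr 1
    ext i
    simp [hyI i]
  have hwI : ∀ i ∈ I₀, w i = ζ := fun i hi =>
    tendsto_nhds_unique (hw i) (tendsto_const_nhds.congr' (by
      filter_upwards [hI] with y hy using ((hy i).2 hi).symm))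
  have hsub : I₀ = Finset.univ.filter fun i => w i = ζ := by
    refine Finset.eq_of_subset_of_card_le (fun i hi => by simpa using hwI i hi) ?_
    have h1 := hk x hx
    rw [hp0, rootMultiplicity_prod] at h1
    rw [hcard, h1]
  have hlim : Tendsto (fun y => ∑ i, branchArg ε (τ y i)) u (𝓝 (∑ i, branchArg ε (w i))) := by
    refine tendsto_finsetSum _ fun i _ => ?_
    by_cases hi : i ∈ I₀
    · refine tendsto_const_nhds.congr' ?_
      filter_upwards [hI] with y hy
      rw [(hy i).2 hi, hwI i hi]
    · have hne : w i ≠ ζ := fun h => hi (by rw [hsub]; simpa using h)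
      exact (continuousAt_branchArg (hw1 i) hne).tendsto.comp (hw i)
  refine hlim.congr' ?_
  filter_upwards [hτ] with y hy
  rw [hy.2, argSum_prod]

/-- A continuous function with values in `2πℤ` on a connected set is constant. -/
lemma eq_of_forall_exists_two_pi_mul {X' : Type*} [TopologicalSpace X'] {s : Set X'}
    (hs : IsPreconnected s) {f : X' → ℝ} (hf : ContinuousOn f s)
    (h : ∀ x ∈ s, Complex.exp (f x * Complex.I) = 1) {x y : X'} (hx : x ∈ s) (hy : y ∈ s) :
    f x = f y := by
  have key : ∀ x ∈ s, ∃ m : ℤ, f x / (2 * Real.pi) = m := by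
    intro x hx
    obtain ⟨m, hm⟩ := Complex.exp_eq_one_iff.1 (h x hx)
    refine ⟨m, ?_⟩
    rw [div_eq_iff Real.two_pi_pos.ne']
    have h2 : (f x : ℂ) = m * (2 * Real.pi) :=
      mul_right_cancel₀ Complex.I_ne_zero (by rw [hm]; ring)
    exact_mod_cast h2
  have hd : IsDiscrete (Set.range ((↑) : ℤ → ℝ)) :=
    Int.isClosedEmbedding_coe_real.isEmbedding.isDiscrete_range
  obtain ⟨c, -, hc⟩ := hs.eqOn_const_of_mapsTo hd
    (f := fun x => f x / (2 * Real.pi)) (hf.div_const _)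
    (fun x hx => (key x hx).imp fun m hm => hm.symm) (Set.range_nonempty _)
  have h1 := (hc hx).trans (hc hy).symm
  simpa using (div_left_inj' Real.two_pi_pos.ne').1 h1

/-- If the multiplicity of the root at the cut is constant on a connected set, then the sum of the
arguments of the roots is, up to a constant, any continuous argument of their product. -/
lemma sub_argSum_eq {X' : Type*} [TopologicalSpace X'] {s : Set X'} (hs : IsPreconnected s) {N : ℕ}
    {p : X' → ℂ[X]} (hp : ∀ x ∈ s, IsCirclePoly N (p x))
    (hc : ∀ z, ContinuousOn (fun x => (p x).eval z) s) (ε : ℝ) (k : ℕ)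
    (hk : ∀ x ∈ s, rootMultiplicity (Complex.exp (((-ε : ℝ) : ℂ) * Complex.I)) (p x) = k)
    {θ : X' → ℝ} (hθ : ContinuousOn θ s)
    (hexp : ∀ x ∈ s, Complex.exp (θ x * Complex.I) = (p x).roots.prod) {x y : X'} (hx : x ∈ s)
    (hy : y ∈ s) : θ x - argSum ε (p x) = θ y - argSum ε (p y) := by
  refine eq_of_forall_exists_two_pi_mul hs (f := fun x => θ x - argSum ε (p x))
    (hθ.sub (continuousOn_argSum hp hc ε k hk)) (fun z hz => ?_) hx hy
  push_cast
  rw [sub_mul, Complex.exp_sub, hexp z hz, (hp z hz).exp_argSum]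
  refine div_self ?_
  rw [← (hp z hz).exp_argSum 0]
  exact Complex.exp_ne_zero _

lemma argSum_sub_argSum_zero {N : ℕ} {p : ℂ[X]} (hp : IsCirclePoly N p) {ε : ℝ}
    (hε : ε ∈ Set.Ioo 0 Real.pi) (h : ∀ z ∈ p.roots, |z.arg| ≠ ε)
    [DecidablePred (· ∈ lowerSector ε)] :
    argSum ε p - argSum 0 p = -(2 * Real.pi) * (p.roots.filter (· ∈ lowerSector ε)).card := by
  rw [argSum, argSum, ← Multiset.sum_map_sub]
  have h1 : p.roots.map (fun z => branchArg ε z - branchArg 0 z) =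
      p.roots.map (fun z => if z ∈ lowerSector ε then -(2 * Real.pi) else 0) :=
    Multiset.map_congr rfl fun z hz =>
      branchArg_sub_branchArg_zero hε (hp.norm_eq_one hz) (h z hz)
  rw [h1]
  induction p.roots using Multiset.induction_on with
  | empty => simp
  | cons z s ih =>
    rw [Multiset.map_cons, Multiset.sum_cons, ih, Multiset.filter_cons]
    split_ifs
    · simp; ring
    · simp

/-! ### The spectral flow and the argument of the determinant -/

section SpectralFlow

variable {V : Type*} [AddCommGroup V] [Module ℂ V] [FiniteDimensional ℂ V]

lemma finrank_finset_sup_eq_sum {ι : Type*} (s : Finset ι) {f : ι → Submodule ℂ V}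
    (hf : iSupIndep f) :
    Module.finrank ℂ (s.sup f : Submodule ℂ V) = ∑ i ∈ s, Module.finrank ℂ (f i) := by
  classical
  induction s using Finset.induction_on with
  | empty => simp
  | insert i s hi ih =>
    rw [Finset.sup_insert, Finset.sum_insert hi, ← ih]
    have hd : Disjoint (f i) (s.sup f) := by
      refine (hf i).mono_right (Finset.sup_le fun j hj => ?_)
      exact le_iSup₂_of_le j (fun h => hi (h ▸ hj)) le_rfl
    have h := Submodule.finrank_sup_add_finrank_inf_eq (f i) (s.sup f)
    rwa [hd.eq_bot, finrank_bot, add_zero] at h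

/-- The dimension of a spectral subspace is the number of roots of the characteristic polynomial
in the set, with multiplicity. -/
lemma spectralDim_eq_card_roots (A : Module.End ℂ V) (N : Set ℂ) [DecidablePred (· ∈ N)] :
    spectralDim A N = (A.charpoly.roots.filter (· ∈ N)).card := by
  classical
  have h1 : (⨆ z ∈ N, A.maxGenEigenspace z : Submodule ℂ V) =
      (A.charpoly.roots.toFinset.filter (· ∈ N)).sup A.maxGenEigenspace := by
    apply le_antisymm
    · refine iSup₂_le fun z hz => ?_
      by_cases hr : z ∈ A.charpoly.roots
      · exact Finset.le_sup (f := A.maxGenEigenspace)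
          (Finset.mem_filter.2 ⟨Multiset.mem_toFinset.2 hr, hz⟩)
      · have h0 : Module.finrank ℂ (A.maxGenEigenspace z) = 0 := by
          rw [LinearMap.finrank_maxGenEigenspace_eq, ← count_roots,
            Multiset.count_eq_zero_of_notMem hr]
        rw [Submodule.finrank_eq_zero.1 h0]
        exact bot_le
    · exact Finset.sup_le fun z hz => le_iSup₂_of_le z (Finset.mem_filter.1 hz).2 le_rfl
  rw [spectralDim, h1, finrank_finset_sup_eq_sum _ A.independent_maxGenEigenspace]
  have h2 : (A.charpoly.roots.filter (· ∈ N)).toFinset =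
      A.charpoly.roots.toFinset.filter (· ∈ N) := Multiset.toFinset_filter _ _
  rw [← h2, ← Multiset.toFinset_sum_count_eq]
  refine Finset.sum_congr rfl fun z hz => ?_
  rw [LinearMap.finrank_maxGenEigenspace_eq, ← count_roots, Multiset.count_filter,
    if_pos (Multiset.mem_filter.1 (Multiset.mem_toFinset.1 hz)).2]

lemma mem_roots_charpoly_iff (A : Module.End ℂ V) (z : ℂ) :
    z ∈ A.charpoly.roots ↔ A.HasEigenvalue z := by
  rw [mem_roots A.charpoly_monic.ne_zero, Module.End.hasEigenvalue_iff_isRoot_charpoly]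

variable {N : ℕ} {a b : ℝ} {A : ℝ → Module.End ℂ V}

/-- The spectral flow through `1` is the change of a continuous argument of the determinant minus
the change of the sum of the arguments of the eigenvalues, taken in `[0, 2π)`. On a subinterval
whose eigenvalues avoid the cut at `exp (-iε)` the former is the change of the sum of the
arguments taken in `[-ε, 2π - ε)`, which differ by `2π` on the arc below `1`. -/
theorem HasSpectralFlow.two_pi_mul_eq {k : ℤ} (h : HasSpectralFlow a b A k)
    (hA : ∀ t ∈ Set.Icc a b, IsCirclePoly N (A t).charpoly)
    (hc : ∀ z, ContinuousOn (fun t => (A t).charpoly.eval z) (Set.Icc a b))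
    {θ : ℝ → ℝ} (hθ : ContinuousOn θ (Set.Icc a b))
    (hexp : ∀ t ∈ Set.Icc a b, Complex.exp (θ t * Complex.I) = (A t).charpoly.roots.prod) :
    2 * Real.pi * k = (θ b - argSum 0 (A b).charpoly) - (θ a - argSum 0 (A a).charpoly) := by
  classical
  obtain ⟨m, s, ε, hs, h0, hm, hε, rfl⟩ := h
  have key : ∀ j ∈ Finset.range m,
      2 * Real.pi * ((spectralDim (A (s j)) (lowerSector (ε j)) : ℝ) -
        (spectralDim (A (s (j + 1))) (lowerSector (ε j)) : ℝ)) =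
      (θ (s (j + 1)) - argSum 0 (A (s (j + 1))).charpoly) -
        (θ (s j) - argSum 0 (A (s j)).charpoly) := by
    intro j hj
    rw [Finset.mem_range] at hj
    obtain ⟨hε1, hε2⟩ := hε j hj
    have hsub : Set.Icc (s j) (s (j + 1)) ⊆ Set.Icc a b :=
      Set.Icc_subset_Icc (h0 ▸ hs (Nat.zero_le j)) (hm ▸ hs hj)
    have hle := hs (Nat.le_succ j)
    have hl : s j ∈ Set.Icc (s j) (s (j + 1)) := Set.left_mem_Icc.2 hle
    have hr : s (j + 1) ∈ Set.Icc (s j) (s (j + 1)) := Set.right_mem_Icc.2 hle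
    have hmult : ∀ t ∈ Set.Icc (s j) (s (j + 1)),
        rootMultiplicity (Complex.exp (((-ε j : ℝ) : ℂ) * Complex.I)) (A t).charpoly = 0 := by
      intro t ht
      rw [← count_roots, Multiset.count_eq_zero, mem_roots_charpoly_iff]
      intro hz
      refine hε2 t ht _ hz ?_
      have h1 : toIocMod Real.two_pi_pos (-Real.pi) (-ε j) = -ε j :=
        (toIocMod_eq_iff _).2 ⟨⟨by linarith [hε1.2], by linarith [hε1.1, Real.pi_pos]⟩, 0, by simp⟩
      rw [Complex.arg_exp_mul_I, h1, abs_neg, abs_of_pos hε1.1]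
    have h1 := sub_argSum_eq isPreconnected_Icc (fun t ht => hA t (hsub ht))
      (fun z => (hc z).mono hsub) (ε j) 0 hmult (hθ.mono hsub) (fun t ht => hexp t (hsub ht)) hl hr
    have h2 := argSum_sub_argSum_zero (hA _ (hsub hl)) hε1
      (fun z hz => hε2 _ hl z ((mem_roots_charpoly_iff _ _).1 hz))
    have h3 := argSum_sub_argSum_zero (hA _ (hsub hr)) hε1
      (fun z hz => hε2 _ hr z ((mem_roots_charpoly_iff _ _).1 hz))
    rw [spectralDim_eq_card_roots, spectralDim_eq_card_roots]
    linarith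
  push_cast
  rw [Finset.mul_sum, Finset.sum_congr rfl key,
    Finset.sum_range_sub (fun j => θ (s j) - argSum 0 (A (s j)).charpoly), h0, hm]

/-- The spectral flow of a continuous path of operators with spectrum on the unit circle exists. -/
theorem exists_hasSpectralFlow (hab : a ≤ b)
    (hA : ∀ t ∈ Set.Icc a b, IsCirclePoly N (A t).charpoly)
    (hc : ∀ z, ContinuousOn (fun t => (A t).charpoly.eval z) (Set.Icc a b)) :
    ∃ k, HasSpectralFlow a b A k := by
  -- For a fixed angle, being free of eigenvalues at that angle is an open condition on `t`.
  let c : Set.Ioo 0 Real.pi → Set (Set.Icc a b) := fun ε =>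
    {t | (A t).charpoly.eval (Complex.exp ((ε : ℝ) * Complex.I)) ≠ 0 ∧
      (A t).charpoly.eval (Complex.exp (((-(ε : ℝ) : ℝ) : ℂ) * Complex.I)) ≠ 0}
  have hopen : ∀ ε, IsOpen (c ε) := fun ε =>
    (isOpen_ne.preimage (continuousOn_iff_continuous_domRestrict.1 (hc _))).inter
      (isOpen_ne.preimage (continuousOn_iff_continuous_domRestrict.1 (hc _)))
  have hspec : ∀ ε, ∀ t ∈ c ε, ∀ z : ℂ, (A t).HasEigenvalue z → |z.arg| ≠ ε := by
    intro ε t ht z hz harg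
    rw [← mem_roots_charpoly_iff] at hz
    have hz1 := exp_arg_mul_I_of_norm_eq_one ((hA t t.2).norm_eq_one hz)
    have hz0 : (A t).charpoly.eval z = 0 := (mem_roots'.1 hz).2
    rcases abs_choice z.arg with h | h
    · rw [h] at harg
      apply ht.1
      rw [← harg, hz1, hz0]
    · rw [h] at harg
      apply ht.2
      rw [← harg, neg_neg, hz1, hz0]
  have hcover : Set.univ ⊆ ⋃ ε, c ε := by
    intro t _
    have hfin : Set.Finite ((fun z : ℂ => |z.arg|) '' {z | z ∈ (A t).charpoly.roots}) :=
      (Multiset.finite_toSet _).image _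
    obtain ⟨ε, hε, hε'⟩ := ((Set.Ioo_infinite Real.pi_pos).sdiff hfin).nonempty
    have harg : ∀ x : ℝ, |x| = ε → (A t).charpoly.eval (Complex.exp (x * Complex.I)) ≠ 0 := by
      intro x hx h0
      refine hε' ⟨Complex.exp (x * Complex.I),
        (mem_roots (A t).charpoly_monic.ne_zero).2 h0, ?_⟩
      have h1 := abs_lt.1 (hx.trans_lt hε.2)
      have h2 : toIocMod Real.two_pi_pos (-Real.pi) x = x :=
        (toIocMod_eq_iff _).2 ⟨⟨h1.1, by linarith⟩, 0, by simp⟩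
      simp only [Complex.arg_exp_mul_I, h2, hx]
    exact Set.mem_iUnion.2 ⟨⟨ε, hε⟩, harg ε (abs_of_pos hε.1),
      harg (-ε) (by rw [abs_neg, abs_of_pos hε.1])⟩
  obtain ⟨s, h0, hs, ⟨m, hm⟩, hseg⟩ := exists_monotone_Icc_subset_open_cover_Icc hab hopen hcover
  choose ε hε using hseg
  refine ⟨_, m, fun j => s j, fun j => ε j, fun i j hij => hs hij, h0, hm m le_rfl,
    fun j _ => ⟨(ε j).2, fun t ht z hz => ?_⟩, rfl⟩
  have htab : t ∈ Set.Icc a b := ⟨(s j).2.1.trans ht.1, ht.2.trans (s (j + 1)).2.2⟩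
  exact hspec (ε j) ⟨t, htab⟩ (hε j ⟨ht.1, ht.2⟩) z hz

end SpectralFlow

/-! ### Continuous arguments -/

/-- A continuous function from a real vector space to the unit circle has a continuous argument. -/
lemma exists_continuous_arg {E : Type*} [NormedAddCommGroup E] [NormedSpace ℝ E] {f : E → ℂ}
    (hf : Continuous f) (h1 : ∀ x, ‖f x‖ = 1) :
    ∃ θ : E → ℝ, Continuous θ ∧ ∀ x, Complex.exp (θ x * Complex.I) = f x := by
  have hmem : ∀ x, f x ∈ Submonoid.unitSphere ℂ := fun x => mem_sphere_zero_iff_norm.2 (h1 x)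
  let g : C(E, Circle) := ⟨fun x => ⟨f x, hmem x⟩, hf.subtype_mk hmem⟩
  obtain ⟨F, ⟨-, hF⟩, -⟩ := Circle.isCoveringMap_exp.existsUnique_continuousMap_lifts g 0
    (g 0 : ℂ).arg (Circle.exp_arg _)
  refine ⟨F, F.continuous, fun x => ?_⟩
  have := congrArg (Subtype.val) (congrFun hF x)
  rwa [Function.comp_apply, Circle.coe_exp] at this

/-! ### Unitary matrices -/

section Unitary

variable {κ : Type*} [Fintype κ] [DecidableEq κ]

omit [DecidableEq κ] in
lemma star_mulVec_dotProduct_mulVec (A B : Matrix κ κ ℂ) (v w : κ → ℂ) :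
    star (A *ᵥ v) ⬝ᵥ (B *ᵥ w) = star v ⬝ᵥ ((Aᴴ * B) *ᵥ w) := by
  rw [star_mulVec, ← dotProduct_mulVec, mulVec_mulVec]

lemma norm_eq_one_of_mem_roots_charpoly {A : Matrix κ κ ℂ} (hA : Aᴴ * A = 1) {z : ℂ}
    (hz : z ∈ A.charpoly.roots) : ‖z‖ = 1 := by
  have h0 : (scalar κ z - A).det = 0 := by
    rw [← eval_charpoly]; exact (mem_roots'.1 hz).2
  obtain ⟨v, hv, hv0⟩ := exists_mulVec_eq_zero_iff.2 h0
  have hAv : A *ᵥ v = z • v := by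
    rw [sub_mulVec, sub_eq_zero] at hv0
    rw [← hv0]
    ext i
    simp [scalar_apply, mulVec_diagonal]
  have h1 := star_mulVec_dotProduct_mulVec A A v v
  rw [hA, one_mulVec, hAv, star_smul, smul_dotProduct, dotProduct_smul, smul_smul,
    smul_eq_mul] at h1
  have h2 : star v ⬝ᵥ v ≠ 0 := dotProduct_star_self_eq_zero.not.2 hv
  have h3 : star z * z = 1 := mul_right_cancel₀ h2 (by rw [h1, one_mul])
  have h4 : ((‖z‖ ^ 2 : ℝ) : ℂ) = 1 := by
    rw [← h3, ← Complex.normSq_eq_norm_sq, Complex.normSq_eq_conj_mul_self]; rfl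
  have h5 : ‖z‖ ^ 2 = 1 := by exact_mod_cast h4
  exact (pow_eq_one_iff_of_nonneg (norm_nonneg z) two_ne_zero).1 h5

lemma isCirclePoly_charpoly {A : Matrix κ κ ℂ} (hA : Aᴴ * A = 1) :
    IsCirclePoly (Fintype.card κ) A.charpoly := by
  have hs : A.charpoly.Splits := IsAlgClosed.splits _
  have hcard : A.charpoly.roots.toList.length = Fintype.card κ := by
    rw [Multiset.length_toList, ← hs.natDegree_eq_card_roots, charpoly_natDegree_eq_dim]
  rw [← hcard]
  have hmap : Finset.univ.val.map A.charpoly.roots.toList.get = A.charpoly.roots := by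
    rw [Fin.univ_val_map, List.ofFn_get, Multiset.coe_toList]
  refine ⟨A.charpoly.roots.toList.get, fun i => norm_eq_one_of_mem_roots_charpoly hA
    (Multiset.mem_toList.1 (List.get_mem _ _)), ?_⟩
  conv_lhs => rw [hs.eq_prod_roots_of_monic A.charpoly_monic, ← hmap, Multiset.map_map]
  rfl

lemma norm_det_eq_one {A : Matrix κ κ ℂ} (hA : Aᴴ * A = 1) : ‖A.det‖ = 1 := by
  have h := (isCirclePoly_charpoly hA).exp_argSum 0
  rw [← det_eq_prod_roots_charpoly] at h
  rw [← h, Complex.norm_exp_ofReal_mul_I]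

/-- For a unitary matrix the algebraic and the geometric multiplicity of the eigenvalue `1`
agree. -/
lemma rootMultiplicity_one_charpoly {A : Matrix κ κ ℂ} (hA : Aᴴ * A = 1) :
    rootMultiplicity 1 A.charpoly = Module.finrank ℂ (LinearMap.ker (toLin' (A - 1))) := by
  rw [← charpoly_toLin', ← LinearMap.finrank_maxGenEigenspace_eq]
  have hlin : toLin' A - (1 : ℂ) • 1 = toLin' (A - 1) := by
    rw [map_sub, toLin'_one, one_smul]; rfl
  -- `ker (A - 1)² = ker (A - 1)`, because `A w = w` implies `Aᴴ w = w`.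
  have key : ∀ v : κ → ℂ, (A - 1) *ᵥ ((A - 1) *ᵥ v) = 0 → (A - 1) *ᵥ v = 0 := by
    intro v hv
    obtain ⟨w, hw⟩ : ∃ w, w = (A - 1) *ᵥ v := ⟨_, rfl⟩
    rw [← hw] at hv ⊢
    have h1 : Aᴴ *ᵥ w = w := by
      rw [sub_mulVec, one_mulVec, sub_eq_zero] at hv
      conv_lhs => rw [← hv, mulVec_mulVec, hA, one_mulVec]
    have h3 : star w ᵥ* A = star w := by
      conv_rhs => rw [← h1, star_mulVec, conjTranspose_conjTranspose]
    have h2 : star w ⬝ᵥ w = 0 := by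
      have h4 : star w ⬝ᵥ ((A - 1) *ᵥ v) = 0 := by
        rw [sub_mulVec, one_mulVec, dotProduct_sub, dotProduct_mulVec, h3, sub_self]
      rwa [← hw] at h4
    exact dotProduct_star_self_eq_zero.1 h2
  have hker : Module.End.maxGenEigenspace (toLin' A) 1 = LinearMap.ker (toLin' (A - 1)) := by
    ext v
    rw [Module.End.mem_maxGenEigenspace, hlin, LinearMap.mem_ker]
    refine ⟨fun ⟨k, hk⟩ => ?_, fun h => ⟨1, by rw [pow_one, h]⟩⟩
    induction k with
    | zero => rw [pow_zero, Module.End.one_apply] at hk; rw [hk, map_zero]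
    | succ k ih =>
      rcases k with _ | k
      · simpa using hk
      · refine ih ?_
        rw [pow_succ', pow_succ', Module.End.mul_apply, Module.End.mul_apply, toLin'_apply,
          toLin'_apply] at hk
        rw [pow_succ', Module.End.mul_apply, toLin'_apply]
        exact key _ hk
  rw [hker]

/-- The eigenvalues of a product of two involutions are symmetric about the real axis, so those
different from `1` have arguments with average `π`. -/
lemma argSum_charpoly_mul {A B : Matrix κ κ ℂ} (hAu : Aᴴ * A = 1) (hBu : Bᴴ * B = 1)
    (hA : A * A = 1) (hB : B * B = 1) :
    argSum 0 (A * B).charpoly =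
      Real.pi * (Fintype.card κ - rootMultiplicity 1 (A * B).charpoly) := by
  classical
  have hAh : Aᴴ = A := by
    rw [← mul_one Aᴴ, ← hA, ← mul_assoc, hAu, one_mul]
  have hBh : Bᴴ = B := by
    rw [← mul_one Bᴴ, ← hB, ← mul_assoc, hBu, one_mul]
  have hABu : (A * B)ᴴ * (A * B) = 1 := by
    rw [conjTranspose_mul, mul_assoc, ← mul_assoc Aᴴ, hAu, one_mul, hBu]
  have hconj : (A * B).charpoly.map (starRingEnd ℂ) = (A * B).charpoly := by
    rw [← charpoly_map, ← charpoly_transpose]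
    have : ((A * B).map (starRingEnd ℂ))ᵀ = (A * B)ᴴ := rfl
    rw [← RingHom.mapMatrix_apply] at this
    simp only [RingHom.mapMatrix_apply] at this
    rw [this, conjTranspose_mul, hAh, hBh, charpoly_mul_comm]
  have hroots : (A * B).charpoly.roots.map (starRingEnd ℂ) = (A * B).charpoly.roots := by
    rw [← (IsAlgClosed.splits (A * B).charpoly).roots_map, hconj]
  have hcirc := isCirclePoly_charpoly hABu
  have hcard : Fintype.card κ = (A * B).charpoly.roots.card := by
    rw [← (IsAlgClosed.splits (A * B).charpoly).natDegree_eq_card_roots, charpoly_natDegree_eq_dim]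
  have hnorm : ∀ z ∈ (A * B).charpoly.roots, ‖z‖ = 1 := fun z hz => hcirc.norm_eq_one hz
  have h1 : argSum 0 (A * B).charpoly =
      ((A * B).charpoly.roots.map fun z => branchArg 0 (starRingEnd ℂ z)).sum := by
    conv_lhs => rw [argSum, ← hroots, Multiset.map_map]
    rfl
  have h2 : argSum 0 (A * B).charpoly + argSum 0 (A * B).charpoly =
      ((A * B).charpoly.roots.map fun z => if z = 1 then 0 else 2 * Real.pi).sum := by
    conv_lhs => rw [h1]
    conv_lhs => lhs; rw [← h1, argSum]
    rw [← Multiset.sum_map_add]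
    exact congrArg Multiset.sum (Multiset.map_congr rfl fun z hz =>
      branchArg_zero_add_conj (hnorm z hz))
  have h3 : ∀ s : Multiset ℂ, (s.map fun z => if z = 1 then 0 else 2 * Real.pi).sum =
      2 * Real.pi * (s.card - s.count 1) := by
    intro s
    induction s using Multiset.induction_on with
    | empty => simp
    | cons z s ih =>
      rw [Multiset.map_cons, Multiset.sum_cons, ih, Multiset.count_cons, Multiset.card_cons]
      by_cases hz : z = 1
      · simp [hz]
      · simp [hz, Ne.symm hz]; ring
  rw [h3, ← hcard, count_roots] at h2
  linarith

/-- The unitary reflection that is `-1` on a subspace and `1` on its orthogonal complement. -/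
lemma exists_reflection_matrix (N : Submodule ℂ (κ → ℂ)) :
    ∃ V : Matrix κ κ ℂ, Vᴴ = V ∧ V * V = 1 ∧ (∀ x, V *ᵥ x = -x ↔ x ∈ N) ∧
      ∀ x, V *ᵥ x = x ↔ ∀ y ∈ N, x ⬝ᵥ star y = 0 := by
  let e := WithLp.linearEquiv 2 ℂ (κ → ℂ)
  let N' : Submodule ℂ (EuclideanSpace ℂ κ) := N.comap e.toLinearMap
  let f : (κ → ℂ) →ₗ[ℂ] (κ → ℂ) :=
    e.toLinearMap ∘ₗ (N'ᗮ.reflection.toLinearEquiv.toLinearMap) ∘ₗ e.symm.toLinearMap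
  have hf : ∀ x, LinearMap.toMatrix' f *ᵥ x = e (N'ᗮ.reflection (e.symm x)) := fun x => by
    rw [← toLin'_apply, toLin'_toMatrix']; rfl
  have hinv : LinearMap.toMatrix' f * LinearMap.toMatrix' f = 1 := by
    rw [← LinearMap.toMatrix'_comp, ← LinearMap.toMatrix'_id]
    congr 1
    refine LinearMap.ext fun x => ?_
    simp [f]
  have hinner : ∀ x y : κ → ℂ, star y ⬝ᵥ x = inner ℂ (e.symm y) (e.symm x) := fun x y => by
    rw [EuclideanSpace.inner_eq_star_dotProduct, dotProduct_comm]; rfl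
  have hunit : (LinearMap.toMatrix' f)ᴴ * LinearMap.toMatrix' f = 1 := by
    refine (Matrix.ext_iff_mulVec.2 fun x => ?_)
    refine dotProduct_eq _ _ fun y => ?_
    rw [dotProduct_comm, ← star_star y, ← star_mulVec_dotProduct_mulVec, hinner, hf, hf,
      LinearEquiv.symm_apply_apply, LinearEquiv.symm_apply_apply, LinearIsometryEquiv.inner_map_map,
      ← hinner, one_mulVec, dotProduct_comm]
  refine ⟨LinearMap.toMatrix' f, ?_, hinv, fun x => ?_, fun x => ?_⟩
  · rw [← mul_one (LinearMap.toMatrix' f)ᴴ, ← hinv, ← mul_assoc, hunit, one_mul]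
  · rw [hf, Submodule.reflection_orthogonal_apply, map_neg, neg_inj, ← e.symm.injective.eq_iff,
      LinearEquiv.symm_apply_apply, Submodule.reflection_eq_self_iff]
    rfl
  · rw [hf, ← e.symm.injective.eq_iff, LinearEquiv.symm_apply_apply,
      Submodule.reflection_eq_self_iff, Submodule.mem_orthogonal]
    refine ⟨fun h y hy => ?_, fun h y hy => ?_⟩
    · rw [dotProduct_comm, hinner]
      exact h (e.symm y) hy
    · have := h (e y) hy
      rwa [dotProduct_comm, hinner, LinearEquiv.symm_apply_apply] at this

end Unitary

/-! ### Coordinates adapted to the symplectic form -/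

/-- The matrix `diag(I, -I)`. -/
def signMatrix (n : ℕ) : Matrix (Fin n ⊕ Fin n) (Fin n ⊕ Fin n) ℂ := fromBlocks 1 0 0 (-1)

@[simp] lemma signMatrix_mul_self (n : ℕ) : signMatrix n * signMatrix n = 1 := by
  simp [signMatrix, fromBlocks_multiply]

@[simp] lemma signMatrix_conjTranspose (n : ℕ) : (signMatrix n)ᴴ = signMatrix n := by
  simp [signMatrix, fromBlocks_conjTranspose]

lemma signMatrix_mulVec {n : ℕ} (x : C2n n) :
    signMatrix n *ᵥ x = Sum.elim (x ∘ Sum.inl) (-(x ∘ Sum.inr)) := by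
  simp [signMatrix, fromBlocks_mulVec, neg_mulVec]

@[simp] lemma signMatrix_mulVec_mulVec {n : ℕ} (x : C2n n) :
    signMatrix n *ᵥ (signMatrix n *ᵥ x) = x := by simp

/-- Position and momentum coordinates `(x₁, x₃)` and `(x₂, x₄)` of the point
`(x₁, x₂, x₃, x₄)` of `ℂ²ⁿ ⊕ ℂ²ⁿ`. -/
def posMom (n : ℕ) : (C2n n × C2n n) ≃ₗ[ℂ] (C2n n × C2n n) where
  toFun v := (Sum.elim (v.1 ∘ Sum.inl) (v.2 ∘ Sum.inl), Sum.elim (v.1 ∘ Sum.inr) (v.2 ∘ Sum.inr))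
  invFun v := (Sum.elim (v.1 ∘ Sum.inl) (v.2 ∘ Sum.inl), Sum.elim (v.1 ∘ Sum.inr) (v.2 ∘ Sum.inr))
  map_add' v w := by
    ext (i | i) <;> simp
  map_smul' c v := by
    ext (i | i) <;> simp
  left_inv v := by
    ext (i | i) <;> simp
  right_inv v := by
    ext (i | i) <;> simp

/-- The coordinates `(q - iSp, q + iSp)`, with `S = diag(I, -I)`, in terms of the position and
momentum coordinates `(q, p)`. They diagonalize the symplectic form. -/
def polarAux (n : ℕ) : (C2n n × C2n n) ≃ₗ[ℂ] (C2n n × C2n n) where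
  toFun v := (v.1 - Complex.I • (signMatrix n *ᵥ v.2), v.1 + Complex.I • (signMatrix n *ᵥ v.2))
  invFun w := ((1 / 2 : ℂ) • (w.1 + w.2), (-Complex.I / 2) • (signMatrix n *ᵥ (w.2 - w.1)))
  map_add' v w := by
    ext i <;> simp [mulVec_add] <;> ring
  map_smul' c v := by
    ext i <;> simp [mulVec_smul] <;> ring
  left_inv v := by
    have h : (v.1 + Complex.I • (signMatrix n *ᵥ v.2)) - (v.1 - Complex.I • (signMatrix n *ᵥ v.2)) =
        (2 * Complex.I) • (signMatrix n *ᵥ v.2) := by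
      ext i; simp; ring
    ext i
    · simp; ring
    · simp only [h, mulVec_smul, signMatrix_mulVec_mulVec, Pi.smul_apply, smul_eq_mul]
      linear_combination (-v.2 i) * Complex.I_mul_I
  right_inv w := by
    ext i
    · simp only [mulVec_smul, signMatrix_mulVec_mulVec, Pi.smul_apply, smul_eq_mul, Pi.sub_apply,
        Pi.add_apply]
      linear_combination (1 / 2) * (w.2 i - w.1 i) * Complex.I_mul_I
    · simp only [mulVec_smul, signMatrix_mulVec_mulVec, Pi.smul_apply, smul_eq_mul, Pi.sub_apply,
        Pi.add_apply]
      linear_combination (-1 / 2) * (w.2 i - w.1 i) * Complex.I_mul_I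

/-- Coordinates on `ℂ²ⁿ ⊕ ℂ²ⁿ` whose two components are coordinates on `H⁺` and on `H⁻`. -/
def polar (n : ℕ) : (C2n n × C2n n) ≃ₗ[ℂ] (C2n n × C2n n) := posMom n ≪≫ₗ polarAux n

lemma polar_fst {n : ℕ} (v : C2n n × C2n n) :
    (polar n v).1 = (posMom n v).1 - Complex.I • (signMatrix n *ᵥ (posMom n v).2) := rfl

lemma polar_snd {n : ℕ} (v : C2n n × C2n n) :
    (polar n v).2 = (posMom n v).1 + Complex.I • (signMatrix n *ᵥ (posMom n v).2) := rfl

lemma posMom_graphForm {n : ℕ} (v : C2n n × C2n n) :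
    posMom n (graphForm n v) =
      (signMatrix n *ᵥ (posMom n v).2, -(signMatrix n *ᵥ (posMom n v).1)) := by
  simp only [signMatrix_mulVec]
  ext (i | i) <;> simp [posMom, graphForm, J, fromBlocks_mulVec, neg_mulVec]

lemma polar_graphForm {n : ℕ} (v : C2n n × C2n n) :
    polar n ((-Complex.I • graphForm n) v) = ((polar n v).1, -(polar n v).2) := by
  have h : posMom n ((-Complex.I • graphForm n) v) =
      -Complex.I • (signMatrix n *ᵥ (posMom n v).2, -(signMatrix n *ᵥ (posMom n v).1)) := by
    rw [LinearMap.smul_apply, map_smul, posMom_graphForm]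
  refine Prod.ext ?_ ?_
  · rw [polar_fst, polar_fst, h]
    ext i
    simp only [Prod.smul_fst, Prod.smul_snd, mulVec_smul, mulVec_neg, signMatrix_mulVec_mulVec,
      Pi.smul_apply, Pi.sub_apply, Pi.neg_apply, smul_eq_mul]
    linear_combination (-(posMom n v).1 i) * Complex.I_mul_I
  · rw [polar_snd, h]
    simp only [polar_snd]
    ext i
    simp only [Prod.smul_fst, Prod.smul_snd, mulVec_smul, mulVec_neg, signMatrix_mulVec_mulVec,
      Pi.smul_apply, Pi.add_apply, Pi.neg_apply, smul_eq_mul]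
    linear_combination ((posMom n v).1 i) * Complex.I_mul_I

lemma mem_eigenspace_graphForm_iff {n : ℕ} (c : ℝ) (v : C2n n × C2n n) :
    v ∈ Module.End.eigenspace (-Complex.I • graphForm n) (c : ℂ) ↔
      (polar n v).1 = (c : ℂ) • (polar n v).1 ∧ -(polar n v).2 = (c : ℂ) • (polar n v).2 := by
  rw [Module.End.mem_eigenspace_iff, ← (polar n).injective.eq_iff, polar_graphForm, map_smul,
    Prod.ext_iff]
  rfl

lemma mem_positiveSpace_iff {n : ℕ} (v : C2n n × C2n n) :
    v ∈ positiveSpace (-Complex.I • graphForm n) ↔ (polar n v).2 = 0 := by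
  constructor
  · have hle : positiveSpace (-Complex.I • graphForm n) ≤
        LinearMap.ker (LinearMap.snd ℂ _ _ ∘ₗ (polar n).toLinearMap) := by
      refine iSup_le fun c w hw => ?_
      have h := ((mem_eigenspace_graphForm_iff c w).1 hw).2
      have hc : (-1 - ((c : ℝ) : ℂ)) ≠ 0 := by
        have h1 : (-1 - (c : ℝ)) ≠ 0 := by
          have : (0 : ℝ) < c := c.2
          linarith
        exact_mod_cast h1
      have h2 : (-1 - ((c : ℝ) : ℂ)) • (polar n w).2 = 0 := by
        rw [sub_smul, ← h, neg_one_smul, sub_self]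
      exact (smul_eq_zero.1 h2).resolve_left hc
    exact fun hv => hle hv
  · intro h
    refine Submodule.mem_iSup_of_mem ⟨1, one_pos⟩ ?_
    rw [mem_eigenspace_graphForm_iff, h]
    simp

lemma mem_negativeSpace_iff {n : ℕ} (v : C2n n × C2n n) :
    v ∈ negativeSpace (-Complex.I • graphForm n) ↔ (polar n v).1 = 0 := by
  constructor
  · have hle : negativeSpace (-Complex.I • graphForm n) ≤
        LinearMap.ker (LinearMap.fst ℂ _ _ ∘ₗ (polar n).toLinearMap) := by
      refine iSup_le fun c w hw => ?_
      have h := ((mem_eigenspace_graphForm_iff c w).1 hw).1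
      have hc : (1 - ((c : ℝ) : ℂ)) ≠ 0 := by
        have h1 : (1 - (c : ℝ)) ≠ 0 := by
          have : (c : ℝ) < 0 := c.2
          linarith
        exact_mod_cast h1
      have h2 : (1 - ((c : ℝ) : ℂ)) • (polar n w).1 = 0 := by
        rw [sub_smul, ← h, one_smul, sub_self]
      exact (smul_eq_zero.1 h2).resolve_left hc
    exact fun hv => hle hv
  · intro h
    refine Submodule.mem_iSup_of_mem ⟨-1, by norm_num⟩ ?_
    rw [mem_eigenspace_graphForm_iff, h]
    simp

/-- The identification of `H⁺` with `ℂ²ⁿ`. -/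
def posEquiv (n : ℕ) : C2n n ≃ₗ[ℂ] positiveSpace (-Complex.I • graphForm n) where
  toFun a := ⟨(polar n).symm (a, 0), by rw [mem_positiveSpace_iff, LinearEquiv.apply_symm_apply]⟩
  invFun v := (polar n v).1
  map_add' a b := by
    refine Subtype.ext ?_
    rw [Submodule.coe_add, ← map_add, Prod.mk_add_mk, add_zero]
  map_smul' c a := by
    refine Subtype.ext ?_
    rw [RingHom.id_apply, Submodule.coe_smul, ← map_smul, Prod.smul_mk, smul_zero]
  left_inv a := by simp
  right_inv v := by
    refine Subtype.ext ((polar n).injective ?_)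
    rw [LinearEquiv.apply_symm_apply]
    exact Prod.ext rfl ((mem_positiveSpace_iff _).1 v.2).symm

/-- The identification of `H⁻` with `ℂ²ⁿ`. -/
def negEquiv (n : ℕ) : C2n n ≃ₗ[ℂ] negativeSpace (-Complex.I • graphForm n) where
  toFun b := ⟨(polar n).symm (0, b), by rw [mem_negativeSpace_iff, LinearEquiv.apply_symm_apply]⟩
  invFun v := (polar n v).2
  map_add' a b := by
    refine Subtype.ext ?_
    rw [Submodule.coe_add, ← map_add, Prod.mk_add_mk, add_zero]
  map_smul' c a := by
    refine Subtype.ext ?_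
    rw [RingHom.id_apply, Submodule.coe_smul, ← map_smul, Prod.smul_mk, smul_zero]
  left_inv a := by simp
  right_inv v := by
    refine Subtype.ext ((polar n).injective ?_)
    rw [LinearEquiv.apply_symm_apply]
    exact Prod.ext ((mem_negativeSpace_iff _).1 v.2).symm rfl

lemma polar_posEquiv {n : ℕ} (a : C2n n) : polar n (posEquiv n a) = (a, 0) :=
  (polar n).apply_symm_apply _

lemma polar_negEquiv {n : ℕ} (b : C2n n) : polar n (negEquiv n b) = (0, b) :=
  (polar n).apply_symm_apply _

lemma mem_splitGraph_iff {n : ℕ} (U : positiveSpace (-Complex.I • graphForm n) →ₗ[ℂ]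
    negativeSpace (-Complex.I • graphForm n)) (v : C2n n × C2n n) :
    v ∈ splitGraph U ↔ U (posEquiv n (polar n v).1) = negEquiv n (polar n v).2 := by
  have hp : ∀ x : positiveSpace (-Complex.I • graphForm n),
      polar n x = ((posEquiv n).symm x, 0) := fun x => by
    conv_lhs => rw [← (posEquiv n).apply_symm_apply x, polar_posEquiv]
  have hm : ∀ x : negativeSpace (-Complex.I • graphForm n),
      polar n x = (0, (negEquiv n).symm x) := fun x => by
    conv_lhs => rw [← (negEquiv n).apply_symm_apply x, polar_negEquiv]
  constructor
  · rintro ⟨x, rfl⟩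
    have h : polar n (((positiveSpace (-Complex.I • graphForm n)).subtype +
        (negativeSpace (-Complex.I • graphForm n)).subtype ∘ₗ U) x) =
        ((posEquiv n).symm x, (negEquiv n).symm (U x)) := by
      rw [LinearMap.add_apply, LinearMap.comp_apply, Submodule.subtype_apply,
        Submodule.subtype_apply, map_add, hp, hm, Prod.mk_add_mk, add_zero, zero_add]
    rw [h, LinearEquiv.apply_symm_apply, LinearEquiv.apply_symm_apply]
  · intro h
    refine ⟨posEquiv n (polar n v).1, (polar n).injective ?_⟩
    rw [LinearMap.add_apply, LinearMap.comp_apply, Submodule.subtype_apply,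
      Submodule.subtype_apply, h, map_add, polar_posEquiv, polar_negEquiv, Prod.mk_add_mk,
      add_zero, zero_add]

lemma splitGraph_injective {n : ℕ} {U V : positiveSpace (-Complex.I • graphForm n) →ₗ[ℂ]
    negativeSpace (-Complex.I • graphForm n)} (h : splitGraph U = splitGraph V) : U = V := by
  refine LinearMap.ext fun x => ?_
  obtain ⟨a, rfl⟩ := (posEquiv n).surjective x
  obtain ⟨b, hb⟩ := (negEquiv n).surjective (U (posEquiv n a))
  have h1 : (polar n).symm (a, b) ∈ splitGraph U := by
    rw [mem_splitGraph_iff, LinearEquiv.apply_symm_apply, hb]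
  rw [h, mem_splitGraph_iff, LinearEquiv.apply_symm_apply, hb] at h1
  exact h1.symm

/-! ### Lagrangian frames -/

/-- The subspace of `ℂ²ⁿ ⊕ ℂ²ⁿ` spanned by the columns of the matrix with position part `X` and
momentum part `Y`. -/
def frameSpan {n : ℕ} (X Y : Matrix (Fin n ⊕ Fin n) (Fin n ⊕ Fin n) ℂ) :
    Submodule ℂ (C2n n × C2n n) :=
  LinearMap.range ((posMom n).symm.toLinearMap ∘ₗ (toLin' X).prod (toLin' Y))

lemma mem_frameSpan_iff {n : ℕ} {X Y : Matrix (Fin n ⊕ Fin n) (Fin n ⊕ Fin n) ℂ}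
    (v : C2n n × C2n n) : v ∈ frameSpan X Y ↔ ∃ x, posMom n v = (X *ᵥ x, Y *ᵥ x) := by
  refine exists_congr fun x => ?_
  rw [LinearMap.comp_apply, LinearEquiv.coe_coe, LinearEquiv.symm_apply_eq, eq_comm]
  rfl

/-- The columns of `(X, Y)` form a basis of a Lagrangian subspace. -/
structure IsLagrangianFrame {n : ℕ} (X Y : Matrix (Fin n ⊕ Fin n) (Fin n ⊕ Fin n) ℂ) : Prop where
  isotropic : Xᴴ * signMatrix n * Y = Yᴴ * signMatrix n * X
  injective : ∀ x, X *ᵥ x = 0 → Y *ᵥ x = 0 → x = 0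

section Frame

variable {n : ℕ} (X Y : Matrix (Fin n ⊕ Fin n) (Fin n ⊕ Fin n) ℂ)

/-- The component in `H⁺` of the frame `(X, Y)`. -/
def framePos : Matrix (Fin n ⊕ Fin n) (Fin n ⊕ Fin n) ℂ := X - Complex.I • (signMatrix n * Y)

/-- The component in `H⁻` of the frame `(X, Y)`. -/
def frameNeg : Matrix (Fin n ⊕ Fin n) (Fin n ⊕ Fin n) ℂ := X + Complex.I • (signMatrix n * Y)

/-- The unitary matrix of the map `H⁺ → H⁻` whose graph is spanned by the frame `(X, Y)`. -/
def frameUnitary : Matrix (Fin n ⊕ Fin n) (Fin n ⊕ Fin n) ℂ := frameNeg X Y * (framePos X Y)⁻¹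

variable {X Y}

lemma IsLagrangianFrame.framePos_conjTranspose_mul (h : IsLagrangianFrame X Y) :
    (framePos X Y)ᴴ * framePos X Y = (frameNeg X Y)ᴴ * frameNeg X Y := by
  have h1 := h.isotropic
  simp only [framePos, frameNeg, conjTranspose_sub, conjTranspose_add, conjTranspose_smul,
    conjTranspose_mul, signMatrix_conjTranspose, sub_mul, mul_sub, add_mul, mul_add, smul_mul_assoc,
    mul_smul_comm, Complex.star_def, Complex.conj_I, ← mul_assoc] at h1 ⊢
  rw [h1]
  module

lemma IsLagrangianFrame.isUnit_framePos (h : IsLagrangianFrame X Y) :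
    IsUnit (framePos X Y).det := by
  rw [isUnit_iff_ne_zero]
  intro h0
  obtain ⟨x, hx, hx0⟩ := exists_mulVec_eq_zero_iff.2 h0
  apply hx
  have h1 : frameNeg X Y *ᵥ x = 0 := by
    rw [← dotProduct_star_self_eq_zero, star_mulVec_dotProduct_mulVec,
      ← h.framePos_conjTranspose_mul, ← star_mulVec_dotProduct_mulVec, hx0, dotProduct_zero]
  rw [framePos, sub_mulVec, smul_mulVec, ← mulVec_mulVec] at hx0
  rw [frameNeg, add_mulVec, smul_mulVec, ← mulVec_mulVec] at h1
  have h2 : (2 : ℂ) • X *ᵥ x = 0 := by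
    rw [show (2 : ℂ) • X *ᵥ x = (X *ᵥ x - Complex.I • signMatrix n *ᵥ Y *ᵥ x) +
      (X *ᵥ x + Complex.I • signMatrix n *ᵥ Y *ᵥ x) by module, hx0, h1, add_zero]
  have h3 : (2 * Complex.I) • (signMatrix n *ᵥ (Y *ᵥ x)) = 0 := by
    rw [show (2 * Complex.I) • (signMatrix n *ᵥ (Y *ᵥ x)) =
      (X *ᵥ x + Complex.I • signMatrix n *ᵥ Y *ᵥ x) -
      (X *ᵥ x - Complex.I • signMatrix n *ᵥ Y *ᵥ x) by module, hx0, h1, sub_zero]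
  have h4 : signMatrix n *ᵥ (Y *ᵥ x) = 0 := (smul_eq_zero.1 h3).resolve_left (by simp)
  refine h.injective x ((smul_eq_zero.1 h2).resolve_left (by simp)) ?_
  rw [← signMatrix_mulVec_mulVec (Y *ᵥ x), h4, mulVec_zero]

lemma IsLagrangianFrame.frameUnitary_mul_framePos (h : IsLagrangianFrame X Y) :
    frameUnitary X Y * framePos X Y = frameNeg X Y := by
  rw [frameUnitary, mul_assoc, nonsing_inv_mul _ h.isUnit_framePos, mul_one]

lemma IsLagrangianFrame.frameUnitary_unitary (h : IsLagrangianFrame X Y) :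
    (frameUnitary X Y)ᴴ * frameUnitary X Y = 1 := by
  have h1 : IsUnit (framePos X Y)ᴴ.det := by
    rw [det_conjTranspose]; exact h.isUnit_framePos.star
  rw [frameUnitary, conjTranspose_mul, mul_assoc, ← mul_assoc (frameNeg X Y)ᴴ,
    ← h.framePos_conjTranspose_mul, mul_assoc (framePos X Y)ᴴ,
    mul_nonsing_inv _ h.isUnit_framePos, mul_one, conjTranspose_nonsing_inv,
    nonsing_inv_mul _ h1]

/-- If `V` fixes the position part of a frame and reverses its momentum part, then the unitary
matrix of the frame is conjugate to `V`, because `V` exchanges the components of the frame in `H⁺`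
and in `H⁻`. -/
lemma frameUnitary_eq_conj
    {V : Matrix (Fin n ⊕ Fin n) (Fin n ⊕ Fin n) ℂ} (hX : X * V = X) (hY : Y * V = -Y) :
    frameUnitary X Y = framePos X Y * V * (framePos X Y)⁻¹ := by
  have : framePos X Y * V = frameNeg X Y := by
    rw [framePos, frameNeg, sub_mul, smul_mul_assoc, mul_assoc, hX, hY, mul_neg, smul_neg,
      sub_neg_eq_add]
  rw [this, frameUnitary]

lemma IsLagrangianFrame.det_frameUnitary (h : IsLagrangianFrame X Y)
    {V : Matrix (Fin n ⊕ Fin n) (Fin n ⊕ Fin n) ℂ} (hX : X * V = X) (hY : Y * V = -Y) :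
    (frameUnitary X Y).det = V.det := by
  rw [frameUnitary_eq_conj hX hY]
  exact det_conj ((isUnit_iff_isUnit_det _).2 h.isUnit_framePos) V

lemma IsLagrangianFrame.frameUnitary_mul_self (h : IsLagrangianFrame X Y)
    {V : Matrix (Fin n ⊕ Fin n) (Fin n ⊕ Fin n) ℂ} (hX : X * V = X) (hY : Y * V = -Y)
    (hV : V * V = 1) : frameUnitary X Y * frameUnitary X Y = 1 := by
  rw [frameUnitary_eq_conj hX hY, mul_assoc, ← mul_assoc _ _ (framePos X Y)⁻¹,
    ← mul_assoc (framePos X Y)⁻¹,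
    nonsing_inv_mul _ h.isUnit_framePos, one_mul, ← mul_assoc, mul_assoc _ V V, hV, mul_one,
    mul_nonsing_inv _ h.isUnit_framePos]

lemma IsLagrangianFrame.mem_frameSpan_iff (h : IsLagrangianFrame X Y) (v : C2n n × C2n n) :
    v ∈ frameSpan X Y ↔ frameUnitary X Y *ᵥ (polar n v).1 = (polar n v).2 := by
  rw [MaslovTheory.mem_frameSpan_iff]
  constructor
  · rintro ⟨x, hx⟩
    have h1 : (polar n v).1 = framePos X Y *ᵥ x := by
      rw [polar_fst, hx, framePos, sub_mulVec, smul_mulVec, mulVec_mulVec]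
    have h2 : (polar n v).2 = frameNeg X Y *ᵥ x := by
      rw [polar_snd, hx, frameNeg, add_mulVec, smul_mulVec, mulVec_mulVec]
    rw [h1, h2, mulVec_mulVec, h.frameUnitary_mul_framePos]
  · intro h1
    refine ⟨(framePos X Y)⁻¹ *ᵥ (polar n v).1, (polarAux n).injective ?_⟩
    set x := (framePos X Y)⁻¹ *ᵥ (polar n v).1 with hx
    have h2 : framePos X Y *ᵥ x = (polar n v).1 := by
      rw [hx, mulVec_mulVec, mul_nonsing_inv _ h.isUnit_framePos, one_mulVec]
    have h3 : frameNeg X Y *ᵥ x = (polar n v).2 := by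
      rw [← h.frameUnitary_mul_framePos, ← mulVec_mulVec, h2, h1]
    refine Prod.ext (h2.symm.trans ?_) (h3.symm.trans ?_)
    · rw [framePos, sub_mulVec, smul_mulVec, ← mulVec_mulVec]; rfl
    · rw [frameNeg, add_mulVec, smul_mulVec, ← mulVec_mulVec]; rfl

/-- The intersection of two Lagrangian subspaces is the eigenspace for the eigenvalue `1`. -/
lemma finrank_frameSpan_inf {Z W : Matrix (Fin n ⊕ Fin n) (Fin n ⊕ Fin n) ℂ}
    (h : IsLagrangianFrame X Y) (h' : IsLagrangianFrame Z W) :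
    Module.finrank ℂ (frameSpan X Y ⊓ frameSpan Z W : Submodule ℂ (C2n n × C2n n)) =
      rootMultiplicity 1 (frameUnitary X Y * (frameUnitary Z W)ᴴ).charpoly := by
  have hU := h.frameUnitary_unitary
  have hV := h'.frameUnitary_unitary
  have hV' := mul_eq_one_comm.1 hV
  rw [rootMultiplicity_one_charpoly (by
    rw [conjTranspose_mul, conjTranspose_conjTranspose, mul_assoc, ← mul_assoc _ᴴ, hU, one_mul,
      hV'])]
  refine LinearEquiv.finrank_eq (LinearEquiv.ofBijective
    (((LinearMap.snd ℂ _ _ ∘ₗ (polar n).toLinearMap).restrict (q := LinearMap.ker _) ?_)) ⟨?_, ?_⟩)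
  · intro v hv
    have h1 := (h.mem_frameSpan_iff v).1 hv.1
    have h2 := (h'.mem_frameSpan_iff v).1 hv.2
    rw [LinearMap.mem_ker, toLin'_apply, sub_mulVec, one_mulVec, sub_eq_zero]
    change (frameUnitary X Y * (frameUnitary Z W)ᴴ) *ᵥ (polar n v).2 = (polar n v).2
    have h3 : (frameUnitary Z W)ᴴ *ᵥ (polar n v).2 = (polar n v).1 := by
      rw [← h2, mulVec_mulVec, hV, one_mulVec]
    rw [← mulVec_mulVec, h3, h1]
  · rw [injective_iff_map_eq_zero]
    rintro ⟨v, hv⟩ h0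
    have h1 := (h.mem_frameSpan_iff v).1 hv.1
    have h2 : (polar n v).2 = 0 := congrArg Subtype.val h0
    have h3 : (polar n v).1 = 0 := by
      rw [← one_mulVec (polar n v).1, ← hU, ← mulVec_mulVec, h1, h2, mulVec_zero]
    exact Subtype.ext ((polar n).injective
      ((Prod.ext h3 h2 : polar n v = 0).trans (map_zero _).symm))
  · rintro ⟨b, hb⟩
    rw [LinearMap.mem_ker, toLin'_apply, sub_mulVec, one_mulVec, sub_eq_zero] at hb
    refine ⟨⟨(polar n).symm ((frameUnitary Z W)ᴴ *ᵥ b, b), ?_, ?_⟩, ?_⟩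
    · refine (h.mem_frameSpan_iff _).2 ?_
      rw [LinearEquiv.apply_symm_apply, mulVec_mulVec, hb]
    · refine (h'.mem_frameSpan_iff _).2 ?_
      rw [LinearEquiv.apply_symm_apply, mulVec_mulVec, hV', one_mulVec]
    · refine Subtype.ext ?_
      change (polar n ((polar n).symm _)).2 = b
      rw [LinearEquiv.apply_symm_apply]

end Frame

/-! ### The Maslov index in terms of frames -/

section MaslovIndex

variable {n : ℕ}

/-- The map `H⁺ → H⁻` with a given unitary matrix. -/
def splitEquiv (U : Matrix (Fin n ⊕ Fin n) (Fin n ⊕ Fin n) ℂ) (hU : Uᴴ * U = 1) :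
    positiveSpace (-Complex.I • graphForm n) ≃ₗ[ℂ] negativeSpace (-Complex.I • graphForm n) :=
  (posEquiv n).symm ≪≫ₗ toLin'OfInv hU (mul_eq_one_comm.1 hU) ≪≫ₗ negEquiv n

lemma IsLagrangianFrame.frameSpan_eq_splitGraph
    {X Y : Matrix (Fin n ⊕ Fin n) (Fin n ⊕ Fin n) ℂ} (h : IsLagrangianFrame X Y) :
    frameSpan X Y = splitGraph (splitEquiv _ h.frameUnitary_unitary).toLinearMap := by
  ext v
  rw [h.mem_frameSpan_iff, mem_splitGraph_iff, ← (negEquiv n).injective.eq_iff]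
  simp [splitEquiv, toLin'OfInv]

lemma splitEquiv_comp_symm {U V : Matrix (Fin n ⊕ Fin n) (Fin n ⊕ Fin n) ℂ} (hU : Uᴴ * U = 1)
    (hV : Vᴴ * V = 1) : (splitEquiv U hU).toLinearMap ∘ₗ (splitEquiv V hV).symm.toLinearMap =
      (negEquiv n).conj (toLin' (U * Vᴴ)) := by
  refine LinearMap.ext fun x => ?_
  simp [splitEquiv, LinearEquiv.conj_apply, toLin'OfInv]

/-- The Maslov index of a path of pairs of Lagrangian subspaces with continuous frames exists, and
it is determined by a continuous argument `θ` of the determinant of the associated unitary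
matrices. -/
theorem hasMaslovIndex_of_frames {a b : ℝ} (hab : a ≤ b) {L M : ℝ → Submodule ℂ (C2n n × C2n n)}
    {X Y Z W : ℝ → Matrix (Fin n ⊕ Fin n) (Fin n ⊕ Fin n) ℂ}
    (h : ∀ t, IsLagrangianFrame (X t) (Y t)) (h' : ∀ t, IsLagrangianFrame (Z t) (W t))
    (hL : ∀ t ∈ Set.Icc a b, L t = frameSpan (X t) (Y t))
    (hM : ∀ t ∈ Set.Icc a b, M t = frameSpan (Z t) (W t))
    {A : ℝ → Matrix (Fin n ⊕ Fin n) (Fin n ⊕ Fin n) ℂ}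
    (hA : ∀ t, A t = frameUnitary (X t) (Y t) * (frameUnitary (Z t) (W t))ᴴ)
    (hc : ContinuousOn A (Set.Icc a b)) {θ : ℝ → ℝ} (hθ : ContinuousOn θ (Set.Icc a b))
    (hexp : ∀ t ∈ Set.Icc a b, Complex.exp (θ t * Complex.I) = (A t).det) :
    (∃ k, HasMaslovIndex (graphForm n) a b L M k) ∧
      ∀ k, HasMaslovIndex (graphForm n) a b L M k →
        -(2 * Real.pi * k) =
          (θ b - argSum 0 (A b).charpoly) - (θ a - argSum 0 (A a).charpoly) := by
  have hunit : ∀ t, (A t)ᴴ * A t = 1 := by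
    intro t
    rw [hA, conjTranspose_mul, conjTranspose_conjTranspose, mul_assoc,
      ← mul_assoc (frameUnitary (X t) (Y t))ᴴ, (h t).frameUnitary_unitary, one_mul,
      mul_eq_one_comm.1 (h' t).frameUnitary_unitary]
  -- The maps in the definition of the index are determined on the interval.
  have key : ∀ U V : ℝ → (positiveSpace (-Complex.I • graphForm n) ≃ₗ[ℂ]
      negativeSpace (-Complex.I • graphForm n)), (∀ t ∈ Set.Icc a b,
        L t = splitGraph (U t).toLinearMap ∧ M t = splitGraph (V t).toLinearMap) →
      ∀ t ∈ Set.Icc a b,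
        ((U t).toLinearMap ∘ₗ (V t).symm.toLinearMap).charpoly = (A t).charpoly := by
    intro U V hUV t ht
    have h1 : U t = splitEquiv _ (h t).frameUnitary_unitary :=
      LinearEquiv.toLinearMap_injective (splitGraph_injective (by
        rw [← (hUV t ht).1, hL t ht, (h t).frameSpan_eq_splitGraph]))
    have h2 : V t = splitEquiv _ (h' t).frameUnitary_unitary :=
      LinearEquiv.toLinearMap_injective (splitGraph_injective (by
        rw [← (hUV t ht).2, hM t ht, (h' t).frameSpan_eq_splitGraph]))
    rw [h1, h2, splitEquiv_comp_symm, LinearEquiv.charpoly_conj, charpoly_toLin', hA]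
  have hcirc : ∀ t, IsCirclePoly (Fintype.card (Fin n ⊕ Fin n)) (A t).charpoly := fun t =>
    isCirclePoly_charpoly (hunit t)
  have heval : ∀ z, ContinuousOn (fun t => (A t).charpoly.eval z) (Set.Icc a b) := by
    intro z
    simp only [eval_charpoly]
    exact (Continuous.matrix_det continuous_id).comp_continuousOn (continuousOn_const.sub hc)
  constructor
  · let U : ℝ → _ := fun t => splitEquiv _ (h t).frameUnitary_unitary
    let V : ℝ → _ := fun t => splitEquiv _ (h' t).frameUnitary_unitary
    have hUV : ∀ t ∈ Set.Icc a b,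
        L t = splitGraph (U t).toLinearMap ∧ M t = splitGraph (V t).toLinearMap := fun t ht =>
      ⟨(hL t ht).trans (h t).frameSpan_eq_splitGraph,
        (hM t ht).trans (h' t).frameSpan_eq_splitGraph⟩
    obtain ⟨k, hk⟩ := exists_hasSpectralFlow (N := Fintype.card (Fin n ⊕ Fin n))
      (A := fun t => (U t).toLinearMap ∘ₗ (V t).symm.toLinearMap) hab
      (fun t ht => by rw [key U V hUV t ht]; exact hcirc t)
      (fun z => (heval z).congr fun t ht => by rw [key U V hUV t ht])
    exact ⟨-k, U, V, hUV, by rwa [neg_neg]⟩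
  · rintro k ⟨U, V, hUV, hk⟩
    have h1 := hk.two_pi_mul_eq (N := Fintype.card (Fin n ⊕ Fin n))
      (fun t ht => by rw [key U V hUV t ht]; exact hcirc t)
      (fun z => (heval z).congr fun t ht => by rw [key U V hUV t ht]) hθ
      (fun t ht => by rw [key U V hUV t ht, hexp t ht, det_eq_prod_roots_charpoly])
    rw [key U V hUV a (Set.left_mem_Icc.2 hab), key U V hUV b (Set.right_mem_Icc.2 hab)] at h1
    rw [← h1]
    push_cast
    ring

lemma existsUnique_of_two_pi_mul_eq {P : ℤ → Prop} {c : ℝ}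
    (h : (∃ k, P k) ∧ ∀ k, P k → -(2 * Real.pi * k) = c) : ∃! k, P k := by
  obtain ⟨⟨k, hk⟩, h⟩ := h
  refine ⟨k, hk, fun l hl => ?_⟩
  have h1 : (2 * Real.pi) * (l : ℝ) = (2 * Real.pi) * k := by linarith [h k hk, h l hl]
  exact_mod_cast mul_left_cancel₀ Real.two_pi_pos.ne' h1

end MaslovIndex

/-! ### Frames of graphs and of boundary conditions -/

section Frames

variable {n : ℕ}

/-- Position part of the frame of the graph of `M`. -/
def graphPos (M : Matrix (Fin n ⊕ Fin n) (Fin n ⊕ Fin n) ℂ) :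
    Matrix (Fin n ⊕ Fin n) (Fin n ⊕ Fin n) ℂ :=
  fromBlocks 1 0 M.toBlocks₁₁ M.toBlocks₁₂

/-- Momentum part of the frame of the graph of `M`. -/
def graphMom (M : Matrix (Fin n ⊕ Fin n) (Fin n ⊕ Fin n) ℂ) :
    Matrix (Fin n ⊕ Fin n) (Fin n ⊕ Fin n) ℂ :=
  fromBlocks 0 1 M.toBlocks₂₁ M.toBlocks₂₂

lemma graphPos_one_mul_signMatrix : graphPos 1 * signMatrix n = graphPos 1 := by
  rw [graphPos, ← fromBlocks_one, toBlocks_fromBlocks₁₁, toBlocks_fromBlocks₁₂, signMatrix,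
    fromBlocks_multiply]
  simp

lemma graphMom_one_mul_signMatrix : graphMom 1 * signMatrix n = -graphMom 1 := by
  rw [graphMom, ← fromBlocks_one, toBlocks_fromBlocks₂₁, toBlocks_fromBlocks₂₂, signMatrix,
    fromBlocks_multiply]
  simp [fromBlocks_neg]

lemma isLagrangianFrame_graph {M : Matrix (Fin n ⊕ Fin n) (Fin n ⊕ Fin n) ℂ}
    (hM : Mᴴ * J (Fin n) ℂ * M = J (Fin n) ℂ) :
    IsLagrangianFrame (graphPos M) (graphMom M) := by
  constructor
  · rw [← fromBlocks_toBlocks M, J, fromBlocks_conjTranspose, fromBlocks_multiply,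
      fromBlocks_multiply, fromBlocks_inj] at hM
    simp only [graphPos, graphMom, fromBlocks_conjTranspose, signMatrix, fromBlocks_multiply,
      conjTranspose_one,
      conjTranspose_zero]
    obtain ⟨h1, h2, h3, h4⟩ := hM
    rw [fromBlocks_inj]
    simp at h1 h2 h3 h4 ⊢
    refine ⟨?_, ?_, ?_, ?_⟩
    · linear_combination (norm := abel) -h1
    · linear_combination (norm := abel) h2
    · linear_combination (norm := abel) h3
    · linear_combination (norm := abel) -h4
  · intro x h1 h2
    rw [graphPos, fromBlocks_mulVec] at h1
    rw [graphMom, fromBlocks_mulVec] at h2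
    ext (i | i)
    · simpa using congrFun h1 (Sum.inl i)
    · simpa using congrFun h2 (Sum.inl i)

lemma graph_eq_frameSpan (M : Matrix (Fin n ⊕ Fin n) (Fin n ⊕ Fin n) ℂ) :
    (toLin' M).graph = frameSpan (graphPos M) (graphMom M) := by
  ext v
  rw [LinearMap.mem_graph_iff, mem_frameSpan_iff, toLin'_apply]
  have key : ∀ x, posMom n (x, M *ᵥ x) = (graphPos M *ᵥ x, graphMom M *ᵥ x) := by
    intro x
    conv_lhs => rw [← fromBlocks_toBlocks M]
    simp only [graphPos, graphMom, fromBlocks_mulVec, posMom]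
    ext (i | i) <;> simp
  constructor
  · intro h
    exact ⟨v.1, by rw [← key, ← h]⟩
  · rintro ⟨x, hx⟩
    rw [← key] at hx
    rw [(posMom n).injective hx]

lemma mem_dualBoundary_iff {R : Submodule ℂ ((Fin n → ℂ) × (Fin n → ℂ))}
    (x : (Fin n → ℂ) × (Fin n → ℂ)) :
    x ∈ dualBoundary R ↔ ∀ y ∈ R, x.1 ⬝ᵥ star y.1 - x.2 ⬝ᵥ star y.2 = 0 := Iff.rfl

lemma mem_boundaryLagrangian_iff {R : Submodule ℂ ((Fin n → ℂ) × (Fin n → ℂ))}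
    (v : C2n n × C2n n) : v ∈ boundaryLagrangian R ↔
      (v.1 ∘ Sum.inl, v.2 ∘ Sum.inl) ∈ dualBoundary R ∧ (v.1 ∘ Sum.inr, v.2 ∘ Sum.inr) ∈ R :=
  Iff.rfl

/-- The position and the momentum part of `W₂(R)` are the `1`- and the `-1`-eigenspace, up to the
sign matrix, of the reflection in a subspace. -/
lemma exists_frame_boundaryLagrangian (R : Submodule ℂ ((Fin n → ℂ) × (Fin n → ℂ))) :
    ∃ (V X Y : Matrix (Fin n ⊕ Fin n) (Fin n ⊕ Fin n) ℂ), V * V = 1 ∧ X * V = X ∧ Y * V = -Y ∧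
      IsLagrangianFrame X Y ∧ boundaryLagrangian R = frameSpan X Y := by
  let N : Submodule ℂ (C2n n) := R.comap
    ((LinearMap.funLeft ℂ ℂ Sum.inl).prod (-LinearMap.funLeft ℂ ℂ Sum.inr))
  obtain ⟨V, hVh, hVV, hN, hN'⟩ := exists_reflection_matrix N
  have hmom : ∀ p : C2n n, (p ∘ Sum.inl, p ∘ Sum.inr) ∈ R ↔ signMatrix n *ᵥ p ∈ N := by
    intro p
    rw [signMatrix_mulVec]
    change _ ↔ ((Sum.elim (p ∘ Sum.inl) (-(p ∘ Sum.inr)) : C2n n) ∘ Sum.inl,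
      -((Sum.elim (p ∘ Sum.inl) (-(p ∘ Sum.inr)) : C2n n) ∘ Sum.inr)) ∈ R
    rw [Sum.elim_comp_inl, Sum.elim_comp_inr, neg_neg]
  have hpos : ∀ q : C2n n, (q ∘ Sum.inl, q ∘ Sum.inr) ∈ dualBoundary R ↔
      ∀ y ∈ N, q ⬝ᵥ star y = 0 := by
    intro q
    rw [mem_dualBoundary_iff]
    constructor
    · intro h y hy
      have := h _ hy
      simpa [dotProduct, Fintype.sum_sum_type] using this
    · intro h y hy
      have h1 : signMatrix n *ᵥ (Sum.elim y.1 y.2 : C2n n) ∈ N := (hmom _).1 (by simpa using hy)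
      have h2 := h _ h1
      rw [signMatrix_mulVec] at h2
      simpa [dotProduct, Fintype.sum_sum_type, sub_eq_add_neg] using h2
  refine ⟨V, 1 + V, -Complex.I • (signMatrix n * (1 - V)), hVV, ?_, ?_, ⟨?_, ?_⟩, ?_⟩
  · rw [add_mul, one_mul, hVV, add_comm]
  · rw [smul_mul_assoc, mul_assoc, sub_mul, one_mul, hVV, ← smul_neg, ← mul_neg, neg_sub]
  · have h1 : (1 + V) * (1 - V) = 0 := by
      rw [add_mul, mul_sub, mul_sub, hVV]; noncomm_ring
    have h2 : (1 - V) * (1 + V) = 0 := by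
      rw [sub_mul, mul_add, mul_add, hVV]; noncomm_ring
    rw [conjTranspose_add, conjTranspose_one, hVh, mul_smul_comm, mul_assoc,
      ← mul_assoc _ _ (1 - V),
      signMatrix_mul_self, one_mul, h1, conjTranspose_smul, conjTranspose_mul, conjTranspose_sub,
      conjTranspose_one, hVh, signMatrix_conjTranspose, smul_mul_assoc, smul_mul_assoc,
      mul_assoc _ _ (signMatrix n), signMatrix_mul_self, mul_one, h2, smul_zero, smul_zero]
  · intro x h1 h2
    rw [smul_mulVec, ← mulVec_mulVec] at h2
    have h3 := (smul_eq_zero.1 h2).resolve_left (by simp)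
    have h4 : (1 - V) *ᵥ x = 0 := by
      rw [← signMatrix_mulVec_mulVec ((1 - V) *ᵥ x), h3, mulVec_zero]
    rw [add_mulVec, one_mulVec] at h1
    rw [sub_mulVec, one_mulVec] at h4
    have h5 : (2 : ℂ) • x = 0 := by
      rw [show (2 : ℂ) • x = (x + V *ᵥ x) + (x - V *ᵥ x) by module, h1, h4, add_zero]
    exact (smul_eq_zero.1 h5).resolve_left (by simp)
  · ext v
    rw [mem_boundaryLagrangian_iff, mem_frameSpan_iff]
    have h1 := hpos (posMom n v).1
    have h2 := hmom (posMom n v).2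
    rw [← hN'] at h1
    rw [← hN] at h2
    have h3 : ((v.1 ∘ Sum.inl, v.2 ∘ Sum.inl) : (Fin n → ℂ) × (Fin n → ℂ)) =
      ((posMom n v).1 ∘ Sum.inl, (posMom n v).1 ∘ Sum.inr) := rfl
    have h4 : ((v.1 ∘ Sum.inr, v.2 ∘ Sum.inr) : (Fin n → ℂ) × (Fin n → ℂ)) =
      ((posMom n v).2 ∘ Sum.inl, (posMom n v).2 ∘ Sum.inr) := rfl
    rw [h3, h4, h1, h2]
    obtain ⟨⟨q, p⟩, hqp⟩ : ∃ w, w = posMom n v := ⟨_, rfl⟩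
    rw [← hqp]
    simp only [Prod.mk.injEq]
    constructor
    · rintro ⟨hq, hp⟩
      refine ⟨(1 / 2 : ℂ) • (q + Complex.I • (signMatrix n *ᵥ p)), ?_, ?_⟩
      · rw [add_mulVec, one_mulVec, mulVec_smul, mulVec_add, mulVec_smul, hq, hp]
        module
      · rw [smul_mulVec, ← mulVec_mulVec, sub_mulVec, one_mulVec, mulVec_smul, mulVec_add,
          mulVec_smul, hq, hp, show (1 / 2 : ℂ) • (q + Complex.I • (signMatrix n *ᵥ p)) -
            (1 / 2 : ℂ) • (q + Complex.I • -(signMatrix n *ᵥ p)) =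
            Complex.I • (signMatrix n *ᵥ p) by module, mulVec_smul, signMatrix_mulVec_mulVec,
          smul_smul, neg_mul, Complex.I_mul_I, neg_neg, one_smul]
    · rintro ⟨x, rfl, rfl⟩
      constructor
      · rw [mulVec_mulVec, mul_add, mul_one, hVV, add_comm]
      · rw [smul_mulVec, ← mulVec_mulVec, mulVec_smul, signMatrix_mulVec_mulVec, mulVec_smul,
          mulVec_mulVec, mul_sub, mul_one, hVV, ← smul_neg, ← neg_mulVec, neg_sub]

/-! ### Change of the boundary condition -/

/-- The action `diag(b*, b⁻¹)` of an invertible matrix `b` on `ℂ²ⁿ`. -/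
def cotangentLift (b : Matrix (Fin n) (Fin n) ℂ) : Matrix (Fin n ⊕ Fin n) (Fin n ⊕ Fin n) ℂ :=
  fromBlocks bᴴ 0 0 b⁻¹

/-- The inverse `diag(b*⁻¹, b)` of `cotangentLift b`. -/
def cotangentLiftInv (b : Matrix (Fin n) (Fin n) ℂ) : Matrix (Fin n ⊕ Fin n) (Fin n ⊕ Fin n) ℂ :=
  fromBlocks (bᴴ)⁻¹ 0 0 b

lemma cotangentLift_mul_inv {b : Matrix (Fin n) (Fin n) ℂ} (hb : IsUnit b.det) :
    cotangentLift b * cotangentLiftInv b = 1 := by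
  have hb' : IsUnit bᴴ.det := by rw [det_conjTranspose]; exact hb.star
  simp [cotangentLift, cotangentLiftInv, fromBlocks_multiply, mul_nonsing_inv _ hb',
    nonsing_inv_mul _ hb]

@[simp] lemma cotangentLift_one : cotangentLift (1 : Matrix (Fin n) (Fin n) ℂ) = 1 := by
  simp [cotangentLift]

@[simp] lemma cotangentLiftInv_one :
    cotangentLiftInv (1 : Matrix (Fin n) (Fin n) ℂ) = 1 := by
  simp [cotangentLiftInv]

lemma changeBoundary_one (R : Submodule ℂ ((Fin n → ℂ) × (Fin n → ℂ))) :
    changeBoundary 1 1 R = R := by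
  simp [changeBoundary]

variable {b₀ b₁ : Matrix (Fin n) (Fin n) ℂ}

/-- Position part of the frame `(X, Y)` moved by `diag(b₀*, b₀⁻¹) ⊕ diag(b₁*, b₁⁻¹)`. -/
def movedPos (b₀ b₁ : Matrix (Fin n) (Fin n) ℂ) (X : Matrix (Fin n ⊕ Fin n) (Fin n ⊕ Fin n) ℂ) :
    Matrix (Fin n ⊕ Fin n) (Fin n ⊕ Fin n) ℂ := fromBlocks b₀ᴴ 0 0 b₁ᴴ * X

/-- Momentum part of the frame `(X, Y)` moved by `diag(b₀*, b₀⁻¹) ⊕ diag(b₁*, b₁⁻¹)`. -/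
def movedMom (b₀ b₁ : Matrix (Fin n) (Fin n) ℂ) (Y : Matrix (Fin n ⊕ Fin n) (Fin n ⊕ Fin n) ℂ) :
    Matrix (Fin n ⊕ Fin n) (Fin n ⊕ Fin n) ℂ := fromBlocks b₀⁻¹ 0 0 b₁⁻¹ * Y

/-- The symplectic map `diag(b₀*, b₀⁻¹) ⊕ diag(b₁*, b₁⁻¹)` of `ℂ²ⁿ ⊕ ℂ²ⁿ`. -/
def boundaryEquiv (h₀ : IsUnit b₀.det) (h₁ : IsUnit b₁.det) :
    (C2n n × C2n n) ≃ₗ[ℂ] (C2n n × C2n n) :=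
  (toLin'OfInv (mul_eq_one_comm.1 (cotangentLift_mul_inv h₀)) (cotangentLift_mul_inv h₀)).prodCongr
    (toLin'OfInv (mul_eq_one_comm.1 (cotangentLift_mul_inv h₁)) (cotangentLift_mul_inv h₁))

lemma boundaryEquiv_apply (h₀ : IsUnit b₀.det) (h₁ : IsUnit b₁.det) (v : C2n n × C2n n) :
    boundaryEquiv h₀ h₁ v = (cotangentLift b₀ *ᵥ v.1, cotangentLift b₁ *ᵥ v.2) := by
  simp [boundaryEquiv, toLin'OfInv]

lemma posMom_boundaryEquiv (h₀ : IsUnit b₀.det) (h₁ : IsUnit b₁.det) (v : C2n n × C2n n) :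
    posMom n (boundaryEquiv h₀ h₁ v) = (fromBlocks b₀ᴴ 0 0 b₁ᴴ *ᵥ (posMom n v).1,
      fromBlocks b₀⁻¹ 0 0 b₁⁻¹ *ᵥ (posMom n v).2) := by
  rw [boundaryEquiv_apply]
  simp only [cotangentLift, fromBlocks_mulVec, posMom]
  ext (i | i) <;> simp

lemma frameSpan_map_boundaryEquiv (h₀ : IsUnit b₀.det) (h₁ : IsUnit b₁.det)
    (X Y : Matrix (Fin n ⊕ Fin n) (Fin n ⊕ Fin n) ℂ) :
    (frameSpan X Y).map (boundaryEquiv h₀ h₁).toLinearMap =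
      frameSpan (movedPos b₀ b₁ X) (movedMom b₀ b₁ Y) := by
  unfold movedPos movedMom
  ext v
  rw [Submodule.mem_map, mem_frameSpan_iff]
  constructor
  · rintro ⟨w, hw, rfl⟩
    obtain ⟨x, hx⟩ := (mem_frameSpan_iff w).1 hw
    refine ⟨x, ?_⟩
    rw [LinearEquiv.coe_coe, posMom_boundaryEquiv, hx, mulVec_mulVec, mulVec_mulVec]
  · rintro ⟨x, hx⟩
    refine ⟨(posMom n).symm (X *ᵥ x, Y *ᵥ x), (mem_frameSpan_iff _).2
      ⟨x, LinearEquiv.apply_symm_apply _ _⟩, (posMom n).injective ?_⟩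
    rw [LinearEquiv.coe_coe, posMom_boundaryEquiv, LinearEquiv.apply_symm_apply, hx,
      mulVec_mulVec, mulVec_mulVec]

lemma graph_map_boundaryEquiv (h₀ : IsUnit b₀.det) (h₁ : IsUnit b₁.det)
    (M : Matrix (Fin n ⊕ Fin n) (Fin n ⊕ Fin n) ℂ) :
    (toLin' M).graph.map (boundaryEquiv h₀ h₁).toLinearMap =
      (toLin' (cotangentLift b₁ * M * cotangentLiftInv b₀)).graph := by
  have h := mul_eq_one_comm.1 (cotangentLift_mul_inv h₀)
  have h' := cotangentLift_mul_inv h₀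
  ext v
  rw [Submodule.mem_map, LinearMap.mem_graph_iff, toLin'_apply]
  constructor
  · rintro ⟨w, hw, rfl⟩
    rw [LinearMap.mem_graph_iff, toLin'_apply] at hw
    rw [LinearEquiv.coe_coe, boundaryEquiv_apply]
    simp only
    rw [hw, mulVec_mulVec, mulVec_mulVec, mul_assoc, h, mul_one]
  · intro hv
    refine ⟨(cotangentLiftInv b₀ *ᵥ v.1, M *ᵥ (cotangentLiftInv b₀ *ᵥ v.1)), ?_, ?_⟩
    · rw [LinearMap.mem_graph_iff, toLin'_apply]
    · rw [LinearEquiv.coe_coe, boundaryEquiv_apply]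
      refine Prod.ext ?_ ?_
      · simp only [mulVec_mulVec, h', one_mulVec]
      · simp only [hv, mulVec_mulVec, mul_assoc]

lemma boundaryLagrangian_map_boundaryEquiv (h₀ : IsUnit b₀.det) (h₁ : IsUnit b₁.det)
    (R : Submodule ℂ ((Fin n → ℂ) × (Fin n → ℂ))) :
    (boundaryLagrangian R).map (boundaryEquiv h₀ h₁).toLinearMap =
      boundaryLagrangian (changeBoundary b₀ b₁ R) := by
  have hcomap : boundaryLagrangian R =
      (boundaryLagrangian (changeBoundary b₀ b₁ R)).comap (boundaryEquiv h₀ h₁).toLinearMap := by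
    ext v
    rw [Submodule.mem_comap, LinearEquiv.coe_coe, boundaryEquiv_apply, mem_boundaryLagrangian_iff,
      mem_boundaryLagrangian_iff, cotangentLift, cotangentLift, fromBlocks_mulVec,
      fromBlocks_mulVec]
    simp only [Sum.elim_comp_inl, Sum.elim_comp_inr, zero_mulVec, add_zero, zero_add]
    refine and_congr ?_ ?_
    · rw [mem_dualBoundary_iff, mem_dualBoundary_iff]
      have hadj : ∀ (b : Matrix (Fin n) (Fin n) ℂ) (x y : Fin n → ℂ),
          (bᴴ *ᵥ x) ⬝ᵥ star y = x ⬝ᵥ star (b *ᵥ y) := by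
        intro b x y
        rw [star_mulVec, ← dotProduct_comm, dotProduct_mulVec, dotProduct_comm]
      simp only [hadj]
      constructor
      · intro h y hy
        exact h (b₀ *ᵥ y.1, b₁ *ᵥ y.2) hy
      · intro h y hy
        have h2 := h (b₀⁻¹ *ᵥ y.1, b₁⁻¹ *ᵥ y.2) (by
          change (b₀ *ᵥ (b₀⁻¹ *ᵥ y.1), b₁ *ᵥ (b₁⁻¹ *ᵥ y.2)) ∈ R
          rwa [mulVec_mulVec, mulVec_mulVec, mul_nonsing_inv _ h₀, mul_nonsing_inv _ h₁,
            one_mulVec, one_mulVec])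
        simpa only [mulVec_mulVec, mul_nonsing_inv _ h₀, mul_nonsing_inv _ h₁, one_mulVec] using h2
    · change _ ↔ (b₀ *ᵥ (b₀⁻¹ *ᵥ (v.1 ∘ Sum.inr)), b₁ *ᵥ (b₁⁻¹ *ᵥ (v.2 ∘ Sum.inr))) ∈ R
      rw [mulVec_mulVec, mulVec_mulVec, mul_nonsing_inv _ h₀, mul_nonsing_inv _ h₁,
        one_mulVec, one_mulVec]
  rw [hcomap, Submodule.map_comap_eq_of_surjective (boundaryEquiv h₀ h₁).surjective]

lemma IsLagrangianFrame.change (h₀ : IsUnit b₀.det) (h₁ : IsUnit b₁.det)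
    {X Y : Matrix (Fin n ⊕ Fin n) (Fin n ⊕ Fin n) ℂ} (h : IsLagrangianFrame X Y) :
    IsLagrangianFrame (movedPos b₀ b₁ X) (movedMom b₀ b₁ Y) := by
  unfold movedPos movedMom
  have h₀' : IsUnit b₀ᴴ.det := by rw [det_conjTranspose]; exact h₀.star
  have h₁' : IsUnit b₁ᴴ.det := by rw [det_conjTranspose]; exact h₁.star
  constructor
  · have e1 : (fromBlocks b₀ᴴ 0 0 b₁ᴴ)ᴴ * signMatrix n * fromBlocks b₀⁻¹ 0 0 b₁⁻¹ =
        signMatrix n := by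
      simp [signMatrix, fromBlocks_conjTranspose, fromBlocks_multiply, mul_nonsing_inv _ h₀,
        mul_nonsing_inv _ h₁]
    have e2 : (fromBlocks b₀⁻¹ 0 0 b₁⁻¹)ᴴ * signMatrix n * fromBlocks b₀ᴴ 0 0 b₁ᴴ =
        signMatrix n := by
      have := congrArg conjTranspose e1
      rwa [conjTranspose_mul, conjTranspose_mul, conjTranspose_conjTranspose,
        signMatrix_conjTranspose, ← mul_assoc] at this
    have h1 : Xᴴ * ((fromBlocks b₀ᴴ 0 0 b₁ᴴ)ᴴ * signMatrix n * fromBlocks b₀⁻¹ 0 0 b₁⁻¹) * Y =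
        Yᴴ * ((fromBlocks b₀⁻¹ 0 0 b₁⁻¹)ᴴ * signMatrix n * fromBlocks b₀ᴴ 0 0 b₁ᴴ) * X := by
      rw [e1, e2, h.isotropic]
    simpa only [conjTranspose_mul, mul_assoc] using h1
  · intro x hX hY
    refine h.injective x ?_ ?_
    · have e : fromBlocks (b₀ᴴ)⁻¹ 0 0 (b₁ᴴ)⁻¹ * fromBlocks b₀ᴴ 0 0 b₁ᴴ = 1 := by
        simp [fromBlocks_multiply, nonsing_inv_mul _ h₀', nonsing_inv_mul _ h₁']
      rw [← one_mulVec (X *ᵥ x), ← e, ← mulVec_mulVec, mulVec_mulVec _ _ X, hX, mulVec_zero]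
    · have e : fromBlocks b₀ 0 0 b₁ * fromBlocks b₀⁻¹ 0 0 b₁⁻¹ = 1 := by
        simp [fromBlocks_multiply, mul_nonsing_inv _ h₀, mul_nonsing_inv _ h₁]
      rw [← one_mulVec (Y *ᵥ x), ← e, ← mulVec_mulVec, mulVec_mulVec _ _ Y, hY, mulVec_zero]

end Frames

/-! ### Dimensions of intersections with the diagonal -/

lemma finrank_add_finrank_orthogonal {κ : Type*} [Fintype κ] [DecidableEq κ]
    {N P : Submodule ℂ (κ → ℂ)} (hP : ∀ x, x ∈ P ↔ ∀ y ∈ N, x ⬝ᵥ star y = 0) :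
    Module.finrank ℂ N + Module.finrank ℂ P = Fintype.card κ := by
  obtain ⟨V, -, hVV, hN, hN'⟩ := exists_reflection_matrix N
  have hcompl : IsCompl N P := by
    constructor
    · rw [Submodule.disjoint_def]
      intro x hx hx'
      have h1 := (hN x).2 hx
      rw [(hN' x).2 ((hP x).1 hx')] at h1
      exact self_eq_neg.1 h1
    · rw [codisjoint_iff, Submodule.eq_top_iff']
      intro x
      have hx : x = (1 / 2 : ℂ) • (x - V *ᵥ x) + (1 / 2 : ℂ) • (x + V *ᵥ x) := by module
      rw [hx]
      refine Submodule.add_mem_sup ((hN _).1 ?_) ((hP _).2 ((hN' _).1 ?_))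
      · rw [mulVec_smul, mulVec_sub, mulVec_mulVec, hVV, one_mulVec]
        module
      · rw [mulVec_smul, mulVec_add, mulVec_mulVec, hVV, one_mulVec]
        module
  rw [Submodule.finrank_add_eq_of_isCompl hcompl, Module.finrank_fintype_fun_eq_card]

section Diagonal

variable {n : ℕ} (R : Submodule ℂ ((Fin n → ℂ) × (Fin n → ℂ)))

lemma mem_diagonal_iff (x : (Fin n → ℂ) × (Fin n → ℂ)) : x ∈ diagonal n ↔ x.2 = x.1 := Iff.rfl

/-- A diagonal vector `(x, x)` lies in `R^{2,b}` when `x` is orthogonal to all differences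
`y₁ - y₂` with `(y₁, y₂) ∈ R`, and the differences that vanish come from the diagonal. -/
lemma finrank_diagonal_inf_dualBoundary :
    Module.finrank ℂ (diagonal n ⊓ dualBoundary R : Submodule ℂ _) + Module.finrank ℂ R =
      Module.finrank ℂ (diagonal n ⊓ R : Submodule ℂ _) + n := by
  let δ : ((Fin n → ℂ) × (Fin n → ℂ)) →ₗ[ℂ] (Fin n → ℂ) := LinearMap.fst ℂ _ _ - LinearMap.snd ℂ _ _
  let ι : (Fin n → ℂ) →ₗ[ℂ] ((Fin n → ℂ) × (Fin n → ℂ)) := LinearMap.id.prod LinearMap.id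
  let P : Submodule ℂ (Fin n → ℂ) := (dualBoundary R).comap ι
  have hP : ∀ x, x ∈ P ↔ ∀ y ∈ R.map δ, x ⬝ᵥ star y = 0 := by
    intro x
    constructor
    · rintro hx _ ⟨y, hy, rfl⟩
      have h2 := (mem_dualBoundary_iff _).1 hx y hy
      simpa [δ, ι, dotProduct_sub] using h2
    · intro h
      refine (mem_dualBoundary_iff _).2 fun y hy => ?_
      have h2 := h (δ y) ⟨y, hy, rfl⟩
      simpa [δ, ι, dotProduct_sub] using h2
  have h1 := finrank_add_finrank_orthogonal hP
  have h2 : Module.finrank ℂ P =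
      Module.finrank ℂ (diagonal n ⊓ dualBoundary R : Submodule ℂ _) := by
    have hι : P.map ι = diagonal n ⊓ dualBoundary R := by
      ext v
      constructor
      · rintro ⟨x, hx, rfl⟩
        exact ⟨rfl, hx⟩
      · rintro ⟨hv, hv'⟩
        have h : ι v.1 = v := Prod.ext rfl ((mem_diagonal_iff v).1 hv).symm
        exact ⟨v.1, by rwa [← h] at hv', h⟩
    rw [← hι]
    exact (Submodule.equivMapOfInjective ι (fun x y h => congrArg Prod.fst h) P).finrank_eq
  have h3 := LinearMap.finrank_range_add_finrank_ker (δ.domRestrict R)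
  have h4 : Module.finrank ℂ (LinearMap.ker (δ.domRestrict R)) =
      Module.finrank ℂ (diagonal n ⊓ R : Submodule ℂ _) := by
    have h5 : (LinearMap.ker (δ.domRestrict R)).map R.subtype = diagonal n ⊓ R := by
      ext y
      constructor
      · rintro ⟨y, hy, rfl⟩
        exact ⟨(sub_eq_zero.1 hy).symm, y.2⟩
      · rintro ⟨hy, hy'⟩
        exact ⟨⟨y, hy'⟩, sub_eq_zero.2 hy.symm, rfl⟩
    rw [← h5, Submodule.finrank_map_subtype_eq]
  rw [LinearMap.range_domRestrict, h4] at h3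
  rw [h2, Fintype.card_fin] at h1
  omega

lemma finrank_graph_one_inf_boundaryLagrangian :
    Module.finrank ℂ ((toLin' (1 : Matrix (Fin n ⊕ Fin n) (Fin n ⊕ Fin n) ℂ)).graph ⊓
      boundaryLagrangian R : Submodule ℂ _) =
      Module.finrank ℂ (diagonal n ⊓ dualBoundary R : Submodule ℂ _) +
        Module.finrank ℂ (diagonal n ⊓ R : Submodule ℂ _) := by
  rw [← Module.finrank_prod]
  let f : ((toLin' (1 : Matrix (Fin n ⊕ Fin n) (Fin n ⊕ Fin n) ℂ)).graph ⊓
      boundaryLagrangian R : Submodule ℂ _) ≃ₗ[ℂ]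
      (diagonal n ⊓ dualBoundary R : Submodule ℂ _) × (diagonal n ⊓ R : Submodule ℂ _) :=
    { toFun := fun v =>
        have h : v.1.2 = v.1.1 := by
          have := (LinearMap.mem_graph_iff _ _).1 v.2.1
          rwa [toLin'_apply, one_mulVec] at this
        (⟨(v.1.1 ∘ Sum.inl, v.1.2 ∘ Sum.inl), (mem_diagonal_iff _).2 (by rw [h]), v.2.2.1⟩,
          ⟨(v.1.1 ∘ Sum.inr, v.1.2 ∘ Sum.inr), (mem_diagonal_iff _).2 (by rw [h]), v.2.2.2⟩)
      invFun := fun w => ⟨(Sum.elim w.1.1.1 w.2.1.1, Sum.elim w.1.1.2 w.2.1.2), by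
        have h1 : w.1.1.2 = w.1.1.1 := w.1.2.1
        have h2 : w.2.1.2 = w.2.1.1 := w.2.2.1
        refine ⟨(LinearMap.mem_graph_iff _ _).2 ?_, (mem_boundaryLagrangian_iff _).2
          ⟨w.1.2.2, w.2.2.2⟩⟩
        rw [toLin'_apply, one_mulVec, h1, h2]⟩
      map_add' := fun _ _ => rfl
      map_smul' := fun _ _ => rfl
      left_inv := fun v => by
        refine Subtype.ext (Prod.ext ?_ ?_)
        · exact Sum.elim_comp_inl_inr _
        · exact Sum.elim_comp_inl_inr _
      right_inv := fun w => rfl }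
  exact f.finrank_eq

lemma finrank_changeBoundary {b₀ b₁ : Matrix (Fin n) (Fin n) ℂ} (h₀ : IsUnit b₀.det)
    (h₁ : IsUnit b₁.det) :
    Module.finrank ℂ (changeBoundary b₀ b₁ R) = Module.finrank ℂ R := by
  have e : ∀ {b : Matrix (Fin n) (Fin n) ℂ}, IsUnit b.det →
      Function.Bijective (toLin' b) := fun {b} h =>
    ⟨fun x y hxy => by
      have := congrArg (fun z => b⁻¹ *ᵥ z) hxy
      simpa [mulVec_mulVec, nonsing_inv_mul _ h] using this,
    fun y => ⟨b⁻¹ *ᵥ y, by simp [mulVec_mulVec, mul_nonsing_inv _ h]⟩⟩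
  have hb : Function.Bijective (LinearMap.prodMap (toLin' b₀) (toLin' b₁)) :=
    (e h₀).prodMap (e h₁)
  have := (LinearEquiv.ofBijective _ hb).finrank_map_eq (changeBoundary b₀ b₁ R)
  have hmap : (changeBoundary b₀ b₁ R).map (LinearEquiv.ofBijective _ hb).toLinearMap = R :=
    Submodule.map_comap_eq_of_surjective hb.2 R
  rw [← this, hmap]

end Diagonal

/-! ### Paths of invertible matrices -/

/-- The general linear group is path connected: the complex line through `1` and `A` contains only
finitely many singular matrices. -/
lemma exists_continuous_path_isUnit_det {κ : Type*} [Fintype κ] [DecidableEq κ]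
    {A : Matrix κ κ ℂ} (hA : IsUnit A.det) :
    ∃ c : ℝ → Matrix κ κ ℂ, Continuous c ∧ (∀ t, IsUnit (c t).det) ∧ (∀ t ≤ 0, c t = 1) ∧
      ∀ t, 1 ≤ t → c t = A := by
  have hfin : Set.Finite {z : ℂ | (1 - z • (1 - A)).det = 0} := by
    have hne : (1 - A).charpolyRev ≠ 0 := by
      intro h
      have := eval_charpolyRev (M := 1 - A)
      rw [h, eval_zero] at this
      exact zero_ne_one this
    refine Set.Finite.subset (Multiset.finite_toSet (1 - A).charpolyRev.roots) fun z hz => ?_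
    refine (mem_roots hne).2 ?_
    rw [IsRoot.def, charpolyRev, ← coe_evalRingHom, RingHom.map_det, ← Set.mem_ofPred.1 hz]
    congr 1
    ext i j
    simp [one_apply, apply_ite (eval z)]
  have hconn := hfin.countable.isPathConnected_compl_of_one_lt_rank
    (by rw [Complex.rank_real_complex]; norm_num)
  obtain ⟨p, hp⟩ := hconn.joinedIn 0 (by simp) 1 (by simpa using hA.ne_zero)
  refine ⟨fun t => 1 - p.extend t • (1 - A), by fun_prop, fun t => ?_, fun t ht => ?_,
    fun t ht => ?_⟩
  · exact isUnit_iff_ne_zero.2 (hp (Set.projIcc 0 1 zero_le_one t))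
  · simp [p.extend_of_le_zero ht]
  · simp [p.extend_of_one_le ht]

lemma continuous_matrix_inv {X' κ : Type*} [TopologicalSpace X'] [Fintype κ] [DecidableEq κ]
    {f : X' → Matrix κ κ ℂ} (hf : Continuous f) (h : ∀ x, IsUnit (f x).det) :
    Continuous fun x => (f x)⁻¹ := by
  simp only [inv_def, Ring.inverse_eq_inv']
  exact (hf.matrix_det.inv₀ fun x => (h x).ne_zero).smul hf.matrix_adjugate

/-! ### The index difference -/

lemma hasMaslovTypeIndex_maslovTypeIndex {n : ℕ} {T : ℝ} {W : Submodule ℂ (C2n n × C2n n)}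
    {γ : ℝ → Matrix (Fin n ⊕ Fin n) (Fin n ⊕ Fin n) ℂ} (h : ∃ k, HasMaslovTypeIndex T W γ k) :
    HasMaslovTypeIndex T W γ (maslovTypeIndex T W γ) := by
  rw [maslovTypeIndex, dif_pos h]
  exact h.choose_spec

section Continuity

variable {n : ℕ} {E : Type*} [TopologicalSpace E]

lemma continuous_graphPos {M : E → Matrix (Fin n ⊕ Fin n) (Fin n ⊕ Fin n) ℂ} (hM : Continuous M) :
    Continuous fun x => graphPos (M x) :=
  continuous_const.matrix_fromBlocks continuous_const
    (continuous_matrix fun _ _ => hM.matrix_elem _ _)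
    (continuous_matrix fun _ _ => hM.matrix_elem _ _)

lemma continuous_graphMom {M : E → Matrix (Fin n ⊕ Fin n) (Fin n ⊕ Fin n) ℂ} (hM : Continuous M) :
    Continuous fun x => graphMom (M x) :=
  continuous_const.matrix_fromBlocks continuous_const
    (continuous_matrix fun _ _ => hM.matrix_elem _ _)
    (continuous_matrix fun _ _ => hM.matrix_elem _ _)

variable {b₀ b₁ : E → Matrix (Fin n) (Fin n) ℂ} {X : E → Matrix (Fin n ⊕ Fin n) (Fin n ⊕ Fin n) ℂ}

lemma continuous_movedPos (h₀ : Continuous b₀) (h₁ : Continuous b₁) (hX : Continuous X) :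
    Continuous fun x => movedPos (b₀ x) (b₁ x) (X x) :=
  (h₀.matrix_conjTranspose.matrix_fromBlocks continuous_const continuous_const
    h₁.matrix_conjTranspose).mul hX

lemma continuous_movedMom (h₀ : Continuous b₀) (h₁ : Continuous b₁) (hu₀ : ∀ x, IsUnit (b₀ x).det)
    (hu₁ : ∀ x, IsUnit (b₁ x).det) (hX : Continuous X) :
    Continuous fun x => movedMom (b₀ x) (b₁ x) (X x) :=
  ((continuous_matrix_inv h₀ hu₀).matrix_fromBlocks continuous_const continuous_const
    (continuous_matrix_inv h₁ hu₁)).mul hX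

lemma continuous_frameUnitary
    {X Y : E → Matrix (Fin n ⊕ Fin n) (Fin n ⊕ Fin n) ℂ} (hX : Continuous X) (hY : Continuous Y)
    (h : ∀ x, IsLagrangianFrame (X x) (Y x)) :
    Continuous fun x => frameUnitary (X x) (Y x) := by
  have hp : Continuous fun x => framePos (X x) (Y x) := by
    unfold framePos
    fun_prop
  have hm : Continuous fun x => frameNeg (X x) (Y x) := by
    unfold frameNeg
    fun_prop
  exact hm.mul (continuous_matrix_inv hp fun x => (h x).isUnit_framePos)

end Continuity

/-- A path in the general linear group can be prolonged to a path of invertible matrices on the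
whole line that starts at `1` at the time `-1`. -/
lemma exists_extended_path {n : ℕ} {T : ℝ} (hT : 0 < T) {a : ℝ → Matrix (Fin n) (Fin n) ℂ}
    (ha : ContinuousOn a (Set.Icc 0 T)) (ha_inv : ∀ t ∈ Set.Icc 0 T, IsUnit (a t)) :
    ∃ b : ℝ → Matrix (Fin n) (Fin n) ℂ, Continuous b ∧ (∀ t, IsUnit (b t).det) ∧ b (-1) = 1 ∧
      ∀ t ∈ Set.Icc 0 T, b t = a t := by
  have h0 : (0 : ℝ) ∈ Set.Icc 0 T := Set.left_mem_Icc.2 hT.le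
  have hdet : ∀ t ∈ Set.Icc 0 T, IsUnit (a t).det := fun t ht =>
    (isUnit_iff_isUnit_det _).1 (ha_inv t ht)
  obtain ⟨c, hc, hcu, hc0, hc1⟩ := exists_continuous_path_isUnit_det (hdet 0 h0)
  have hext : Continuous fun t => a (Set.projIcc 0 T hT.le t) :=
    ha.comp_continuous (continuous_subtype_val.comp continuous_projIcc)
      fun t => (Set.projIcc 0 T hT.le t).2
  refine ⟨fun t => c (t + 1) * (a 0)⁻¹ * a (Set.projIcc 0 T hT.le t), ?_, fun t => ?_, ?_,
    fun t ht => ?_⟩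
  · exact ((hc.comp (by fun_prop)).mul continuous_const).mul hext
  · rw [det_mul, det_mul]
    exact ((hcu _).mul ((isUnit_nonsing_inv_det_iff).2 (hdet 0 h0))).mul
      (hdet _ (Set.projIcc 0 T hT.le t).2)
  · have : (Set.projIcc 0 T hT.le (-1) : ℝ) = 0 := by
      rw [Set.projIcc_of_le_left hT.le (by norm_num)]
    simp only [this]
    rw [hc0 _ (by norm_num), one_mul, nonsing_inv_mul _ (hdet 0 h0)]
  · have : (Set.projIcc 0 T hT.le t : ℝ) = t := by
      rw [Set.projIcc_of_mem hT.le ht]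
    simp only [this]
    rw [hc1 _ (by linarith [ht.1]), mul_nonsing_inv _ (hdet 0 h0), one_mul]

/-- The index difference in terms of the intersections of the boundary conditions with the graph of
the identity. Both index paths lie in one family over `ℝ × ℝ × ℝ`, whose points `(r, s, t)` stand
for the graph of `γ t` moved by `diag(b(r)*, b(r)⁻¹) ⊕ diag(b(s)*, b(s)⁻¹)`. -/
theorem index_difference {n : ℕ} {T : ℝ} (hT : 0 < T) {b : ℝ → Matrix (Fin n) (Fin n) ℂ}
    (hb : Continuous b) (hbu : ∀ t, IsUnit (b t).det) (hb1 : b (-1) = 1)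
    (R : Submodule ℂ ((Fin n → ℂ) × (Fin n → ℂ)))
    {γ : ℝ → Matrix (Fin n ⊕ Fin n) (Fin n ⊕ Fin n) ℂ} (hγ : Continuous γ)
    (hγ_symp : ∀ t, (γ t)ᴴ * J (Fin n) ℂ * γ t = J (Fin n) ℂ) (hγ_zero : γ 0 = 1)
    {L L' : ℝ → Submodule ℂ (C2n n × C2n n)}
    (hL : ∀ t ∈ Set.Icc 0 T, L t = (toLin' (γ t)).graph)
    (hL' : ∀ t ∈ Set.Icc 0 T,
      L' t = (toLin' (cotangentLift (b t) * γ t * cotangentLiftInv (b 0))).graph) :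
    (∃! k, HasMaslovIndex (graphForm n) 0 T L (fun _ => boundaryLagrangian R) k) ∧
    (∃! k, HasMaslovIndex (graphForm n) 0 T L'
      (fun _ => boundaryLagrangian (changeBoundary (b 0) (b T) R)) k) ∧
    ∀ k k' : ℤ, HasMaslovIndex (graphForm n) 0 T L (fun _ => boundaryLagrangian R) k →
      HasMaslovIndex (graphForm n) 0 T L'
        (fun _ => boundaryLagrangian (changeBoundary (b 0) (b T) R)) k' →
      2 * (k' - k) =
        (Module.finrank ℂ ((toLin' (1 : Matrix (Fin n ⊕ Fin n) (Fin n ⊕ Fin n) ℂ)).graph ⊓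
          boundaryLagrangian (changeBoundary (b 0) (b T) R) : Submodule ℂ _) : ℤ) -
        (Module.finrank ℂ ((toLin' (1 : Matrix (Fin n ⊕ Fin n) (Fin n ⊕ Fin n) ℂ)).graph ⊓
          boundaryLagrangian R : Submodule ℂ _) : ℤ) := by
  obtain ⟨V₀, Z, W, hV₀, hZ, hW, hZW, hR⟩ := exists_frame_boundaryLagrangian R
  let X : ℝ → ℝ → ℝ → Matrix (Fin n ⊕ Fin n) (Fin n ⊕ Fin n) ℂ :=
    fun r s t => movedPos (b r) (b s) (graphPos (γ t))
  let Y : ℝ → ℝ → ℝ → Matrix (Fin n ⊕ Fin n) (Fin n ⊕ Fin n) ℂ :=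
    fun r s t => movedMom (b r) (b s) (graphMom (γ t))
  have hXY : ∀ r s t, IsLagrangianFrame (X r s t) (Y r s t) := fun r s t =>
    (isLagrangianFrame_graph (hγ_symp t)).change (hbu r) (hbu s)
  have hZW' : ∀ r s, IsLagrangianFrame (movedPos (b r) (b s) Z) (movedMom (b r) (b s) W) :=
    fun r s => hZW.change (hbu r) (hbu s)
  have hgraph : ∀ r s t, frameSpan (X r s t) (Y r s t) =
      (toLin' (cotangentLift (b s) * γ t * cotangentLiftInv (b r))).graph := fun r s t => by
    rw [← graph_map_boundaryEquiv (hbu r) (hbu s), graph_eq_frameSpan, frameSpan_map_boundaryEquiv]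
  have hbdry : ∀ r s, frameSpan (movedPos (b r) (b s) Z) (movedMom (b r) (b s) W) =
      boundaryLagrangian (changeBoundary (b r) (b s) R) := fun r s => by
    rw [← boundaryLagrangian_map_boundaryEquiv (hbu r) (hbu s), hR, frameSpan_map_boundaryEquiv]
  let U : ℝ → ℝ → ℝ → Matrix (Fin n ⊕ Fin n) (Fin n ⊕ Fin n) ℂ :=
    fun r s t => frameUnitary (X r s t) (Y r s t)
  let V : ℝ → ℝ → Matrix (Fin n ⊕ Fin n) (Fin n ⊕ Fin n) ℂ :=
    fun r s => frameUnitary (movedPos (b r) (b s) Z) (movedMom (b r) (b s) W)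
  have hUu : ∀ r s t, (U r s t)ᴴ * U r s t = 1 := fun r s t => (hXY r s t).frameUnitary_unitary
  have hVu : ∀ r s, (V r s)ᴴ * V r s = 1 := fun r s => (hZW' r s).frameUnitary_unitary
  have hUc : Continuous fun p : ℝ × ℝ × ℝ => U p.1 p.2.1 p.2.2 := by
    have hγ' : Continuous fun p : ℝ × ℝ × ℝ => γ p.2.2 := by fun_prop
    exact continuous_frameUnitary
      (continuous_movedPos (by fun_prop) (by fun_prop) (continuous_graphPos hγ'))
      (continuous_movedMom (by fun_prop) (by fun_prop) (fun p => hbu p.1) (fun p => hbu p.2.1)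
        (continuous_graphMom hγ'))
      fun p => hXY p.1 p.2.1 p.2.2
  have hVc : Continuous fun p : ℝ × ℝ => V p.1 p.2 :=
    continuous_frameUnitary
      (continuous_movedPos (by fun_prop) (by fun_prop) continuous_const)
      (continuous_movedMom (by fun_prop) (by fun_prop) (fun p => hbu p.1) (fun p => hbu p.2)
        continuous_const)
      fun p => hZW' p.1 p.2
  have hVV : ∀ r s, V r s * V r s = 1 := fun r s =>
    (hZW' r s).frameUnitary_mul_self (V := V₀) (by rw [movedPos, mul_assoc, hZ])
      (by rw [movedMom, mul_assoc, hW, mul_neg]) hV₀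
  have hVdet : ∀ r s, (V r s).det = V₀.det := fun r s =>
    (hZW' r s).det_frameUnitary (by rw [movedPos, mul_assoc, hZ])
      (by rw [movedMom, mul_assoc, hW, mul_neg])
  have hVh : ∀ r s, (V r s)ᴴ = V r s := fun r s => by
    rw [← mul_one (V r s)ᴴ, ← hVV r s, ← mul_assoc, hVu, one_mul]
  -- At `t = 0` the frame is split by the involution `diag(I, -I)`.
  have hX0 : ∀ r s, X r s 0 * signMatrix n = X r s 0 := fun r s => by
    change movedPos _ _ _ * _ = movedPos _ _ _
    rw [hγ_zero, movedPos, mul_assoc, graphPos_one_mul_signMatrix]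
  have hY0 : ∀ r s, Y r s 0 * signMatrix n = -Y r s 0 := fun r s => by
    change movedMom _ _ _ * _ = -movedMom _ _ _
    rw [hγ_zero, movedMom, mul_assoc, graphMom_one_mul_signMatrix, mul_neg]
  have hU0 : ∀ r s, U r s 0 * U r s 0 = 1 := fun r s =>
    (hXY r s 0).frameUnitary_mul_self (hX0 r s) (hY0 r s) (signMatrix_mul_self n)
  have hU0det : ∀ r s, (U r s 0).det = (signMatrix n).det := fun r s =>
    (hXY r s 0).det_frameUnitary (hX0 r s) (hY0 r s)
  obtain ⟨θ, hθ, hθexp⟩ := exists_continuous_arg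
    (f := fun p : ℝ × ℝ × ℝ => (U p.1 p.2.1 p.2.2).det * V₀.det)
    (hUc.matrix_det.mul continuous_const) (fun p => by
      rw [norm_mul, norm_det_eq_one (hUu _ _ _), ← hVdet 0 0, norm_det_eq_one (hVu _ _), one_mul])
  have hdet : ∀ r s t r' s', Complex.exp (θ (r, s, t) * Complex.I) =
      (U r s t * (V r' s')ᴴ).det := fun r s t r' s' => by
    rw [hθexp, det_mul, hVh, hVdet]
  have hAu : ∀ r s t r' s', (U r s t * (V r' s')ᴴ)ᴴ * (U r s t * (V r' s')ᴴ) = 1 := by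
    intro r s t r' s'
    rw [conjTranspose_mul, conjTranspose_conjTranspose, mul_assoc, ← mul_assoc (U r s t)ᴴ, hUu,
      one_mul, mul_eq_one_comm.1 (hVu r' s')]
  -- The two indices through a common continuous argument.
  have hind := hasMaslovIndex_of_frames hT.le (L := L) (M := fun _ => boundaryLagrangian R)
    (fun t => hXY (-1) (-1) t) (fun _ => hZW' (-1) (-1))
    (fun t ht => by rw [hL t ht, hgraph, hb1]; simp)
    (fun t _ => by rw [hbdry, hb1, changeBoundary_one])
    (A := fun t => U (-1) (-1) t * (V (-1) (-1))ᴴ) (fun t => rfl)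
    ((hUc.comp (by fun_prop : Continuous fun t : ℝ => ((-1 : ℝ), (-1 : ℝ), t))).mul
      continuous_const).continuousOn
    (θ := fun t => θ (-1, -1, t)) (hθ.comp (by fun_prop)).continuousOn
    (fun t _ => hdet _ _ _ _ _)
  have hind' := hasMaslovIndex_of_frames hT.le (L := L')
    (M := fun _ => boundaryLagrangian (changeBoundary (b 0) (b T) R))
    (fun t => hXY 0 t t) (fun _ => hZW' 0 T)
    (fun t ht => by rw [hL' t ht, hgraph])
    (fun t _ => by rw [hbdry])
    (A := fun t => U 0 t t * (V 0 T)ᴴ) (fun t => rfl)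
    ((hUc.comp (by fun_prop : Continuous fun t : ℝ => ((0 : ℝ), t, t))).mul
      continuous_const).continuousOn
    (θ := fun t => θ (0, t, t)) (hθ.comp (by fun_prop)).continuousOn
    (fun t _ => hdet _ _ _ _ _)
  refine ⟨existsUnique_of_two_pi_mul_eq hind, existsUnique_of_two_pi_mul_eq hind', ?_⟩
  intro k k' hk hk'
  have h1 := hind.2 k hk
  have h2 := hind'.2 k' hk'
  -- The determinant is constant on the face `t = 0`.
  have h3 : θ (0, 0, 0) = θ (-1, -1, 0) := by
    have := eq_of_forall_exists_two_pi_mul (X' := ℝ × ℝ) isPreconnected_univ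
      (f := fun p => θ (p.1, p.2, 0) - θ (-1, -1, 0)) (by fun_prop) (fun p _ => by
        push_cast
        rw [sub_mul, Complex.exp_sub, hθexp, hθexp]
        simp only [hU0det]
        rw [div_self]
        rw [← hU0det 0 0, ← hVdet 0 0, ← det_mul, ← hVh]
        intro h0
        have := norm_det_eq_one (hAu 0 0 0 0 0)
        rw [h0, norm_zero] at this
        exact zero_ne_one this)
      (Set.mem_univ (0, 0)) (Set.mem_univ (-1, -1))
    simp only at this
    linarith
  -- On the face `t = T` the two Lagrangian subspaces move by a common symplectic map, so that
  -- the dimension of their intersection does not change.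
  have hmult : ∀ r s, rootMultiplicity 1 (U r s T * (V r s)ᴴ).charpoly =
      Module.finrank ℂ ((toLin' (γ T)).graph ⊓ boundaryLagrangian R : Submodule ℂ _) := by
    intro r s
    rw [← finrank_frameSpan_inf (hXY r s T) (hZW' r s), hgraph, hbdry,
      ← graph_map_boundaryEquiv (hbu r) (hbu s),
      ← boundaryLagrangian_map_boundaryEquiv (hbu r) (hbu s),
      ← Submodule.map_inf _ (boundaryEquiv (hbu r) (hbu s)).injective]
    exact (boundaryEquiv (hbu r) (hbu s)).finrank_map_eq _
  have h4 : θ (-1, -1, T) - argSum 0 (U (-1) (-1) T * (V (-1) (-1))ᴴ).charpoly =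
      θ (0, T, T) - argSum 0 (U 0 T T * (V 0 T)ᴴ).charpoly := by
    have hAc : Continuous fun p : ℝ × ℝ => U p.1 p.2 T * (V p.1 p.2)ᴴ :=
      (hUc.comp (by fun_prop : Continuous fun p : ℝ × ℝ => (p.1, p.2, T))).mul
        hVc.matrix_conjTranspose
    exact sub_argSum_eq (X' := ℝ × ℝ) isPreconnected_univ
      (p := fun p => (U p.1 p.2 T * (V p.1 p.2)ᴴ).charpoly)
      (fun p _ => isCirclePoly_charpoly (hAu _ _ _ _ _))
      (fun z => by
        simp only [eval_charpoly]
        exact (continuous_const.sub hAc).matrix_det.continuousOn)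
      0 _ (fun p _ => by
        rw [neg_zero, Complex.ofReal_zero, zero_mul, Complex.exp_zero]
        exact hmult p.1 p.2)
      (θ := fun p => θ (p.1, p.2, T)) (by fun_prop)
      (fun p _ => by rw [← det_eq_prod_roots_charpoly]; exact hdet _ _ _ _ _)
      (Set.mem_univ (-1, -1)) (Set.mem_univ (0, T))
  have hVu' : ∀ r s, ((V r s)ᴴ)ᴴ * (V r s)ᴴ = 1 := fun r s => by
    rw [conjTranspose_conjTranspose, mul_eq_one_comm.1 (hVu r s)]
  have hVV' : ∀ r s, (V r s)ᴴ * (V r s)ᴴ = 1 := fun r s => by rw [hVh, hVV]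
  have h5 := argSum_charpoly_mul (hUu (-1) (-1) 0) (hVu' (-1) (-1)) (hU0 _ _) (hVV' _ _)
  have h6 := argSum_charpoly_mul (hUu 0 0 0) (hVu' 0 T) (hU0 _ _) (hVV' _ _)
  rw [← finrank_frameSpan_inf (hXY _ _ _) (hZW' _ _), hgraph, hbdry, hγ_zero] at h5 h6
  rw [hb1, cotangentLift_one, cotangentLiftInv_one, mul_one, mul_one, changeBoundary_one] at h5
  rw [mul_one, cotangentLift_mul_inv (hbu 0)] at h6
  have h7 : (2 * Real.pi * (k' - k) : ℝ) =
      Real.pi * (Module.finrank ℂ ((toLin' (1 : Matrix (Fin n ⊕ Fin n) (Fin n ⊕ Fin n) ℂ)).graph ⊓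
          boundaryLagrangian (changeBoundary (b 0) (b T) R) : Submodule ℂ _)) -
        Real.pi * (Module.finrank ℂ ((toLin' (1 : Matrix (Fin n ⊕ Fin n) (Fin n ⊕ Fin n) ℂ)).graph ⊓
          boundaryLagrangian R : Submodule ℂ _)) := by
    linear_combination -h2 + h1 + h3 + h4 + h5 - h6
  have h8 := mul_left_cancel₀ Real.pi_pos.ne' ((by ring : Real.pi * (2 * (k' - k) : ℝ) =
    2 * Real.pi * (k' - k)).trans (h7.trans (mul_sub _ _ _).symm))
  exact_mod_cast h8

end MaslovTheory

end


theorem theorem2p3 (n : ℕ) (T : ℝ) (hT : 0 < T)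
    (a : ℝ → Matrix (Fin n) (Fin n) ℂ) (ha : ContinuousOn a (Set.Icc 0 T))
    (ha_inv : ∀ t ∈ Set.Icc 0 T, IsUnit (a t))
    (R : Submodule ℂ ((Fin n → ℂ) × (Fin n → ℂ)))
    (γ : ℝ → Matrix (Fin n ⊕ Fin n) (Fin n ⊕ Fin n) ℂ) (hγ : ContinuousOn γ (Set.Icc 0 T))
    (hγ_symp : ∀ t ∈ Set.Icc 0 T, (γ t)ᴴ * Matrix.J (Fin n) ℂ * γ t = Matrix.J (Fin n) ℂ)
    (hγ_zero : γ 0 = 1) :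
    (∃! k, MaslovTheory.HasMaslovTypeIndex T (MaslovTheory.boundaryLagrangian R) γ k) ∧
    (∃! k, MaslovTheory.HasMaslovTypeIndex T
      (MaslovTheory.boundaryLagrangian (MaslovTheory.changeBoundary (a 0) (a T) R))
      (MaslovTheory.changePath a γ) k) ∧
    MaslovTheory.maslovTypeIndex T
        (MaslovTheory.boundaryLagrangian (MaslovTheory.changeBoundary (a 0) (a T) R))
        (MaslovTheory.changePath a γ) -
      MaslovTheory.maslovTypeIndex T (MaslovTheory.boundaryLagrangian R) γ =
    (Module.finrank ℂ ↥(MaslovTheory.diagonal n ⊓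
        MaslovTheory.dualBoundary (MaslovTheory.changeBoundary (a 0) (a T) R)) : ℤ) -
      (Module.finrank ℂ ↥(MaslovTheory.diagonal n ⊓ MaslovTheory.dualBoundary R) : ℤ) := by
  open MaslovTheory in
  obtain ⟨b, hb, hbu, hb1, hba⟩ := exists_extended_path hT ha ha_inv
  have h0 : (0 : ℝ) ∈ Set.Icc 0 T := Set.left_mem_Icc.2 hT.le
  have hT' : T ∈ Set.Icc 0 T := Set.right_mem_Icc.2 hT.le
  have hproj : ∀ t ∈ Set.Icc 0 T, (Set.projIcc 0 T hT.le t : ℝ) = t := fun t ht => by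
    rw [Set.projIcc_of_mem hT.le ht]
  obtain ⟨h1, h2, h3⟩ := index_difference hT hb hbu hb1 R
    (γ := fun t => γ (Set.projIcc 0 T hT.le t))
    (hγ.comp_continuous (continuous_subtype_val.comp continuous_projIcc)
      fun t => (Set.projIcc 0 T hT.le t).2)
    (fun t => hγ_symp _ (Set.projIcc 0 T hT.le t).2)
    (by simp only [hproj 0 h0, hγ_zero])
    (L := fun t => (toLin' (γ t)).graph) (L' := fun t => (toLin' (changePath a γ t)).graph)
    (fun t ht => by simp only [hproj t ht])
    (fun t ht => by simp only [hproj t ht, hba t ht, hba 0 h0]; rfl)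
  rw [hba 0 h0, hba T hT'] at h2 h3
  refine ⟨h1, h2, ?_⟩
  have h4 := h3 _ _ (hasMaslovTypeIndex_maslovTypeIndex h1.exists)
    (hasMaslovTypeIndex_maslovTypeIndex h2.exists)
  have h5 := finrank_changeBoundary R (hba 0 h0 ▸ hbu 0) (hba T hT' ▸ hbu T)
  have h6 := finrank_diagonal_inf_dualBoundary R
  have h7 := finrank_diagonal_inf_dualBoundary (changeBoundary (a 0) (a T) R)
  rw [finrank_graph_one_inf_boundaryLagrangian, finrank_graph_one_inf_boundaryLagrangian] at h4
  omega
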